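/- Let $\mathfrak{sl}(2)$ be the real Lie algebra with basis $X_1,X_2,X_3$ and brackets $[X_1,X_2]=-X_3$, $[X_3,X_1]=X_2$, $[X_3,X_2]=-X_1$; let $x_1,x_2,x_3$ be the corresponding coordinates on $\mathfrak{sl}(2)^*\cong\mathbb R^3$, and let $\Omega=\mathfrak{sl}(2)^*\setminus\{0\}$ carry its linear Poisson bivector $\Lambda$, $\Lambda(dx_i,dx_j)(x)=\langle x,[X_i,X_j]\rangle$ (of constant rank $2$). For $f\in C^\infty(\Omega)$ write $H_f=\{f,\cdot\}$, and let $I(\Omega)$ be the algebra of Casimir functions (those $f$ with $H_f=0$). Let $\sigma=[\Lambda,\cdot]$ (Schouten bracket). The P-cohomology $H^k_\Lambda(\Omega)$ is the cohomology of $\sigma$ on smooth multivector fields on $\Omega$; the TP-cohomology $H^k_{\Lambda,tan}(\Omega)$ is the cohomology of $\sigma$ on smooth multivector fields tangent to the symplectic leaves. Both are modules over $\mathbb R$, over the ring $S(\mathfrak g)^G$ of $G$-invariant polynomial functions on $\mathfrak{sl}(2)^*$, and over the ring $\mathcal A(\mathfrak g)^G$ of $G$-invariant real-analytic functions on $\mathfrak{sl}(2)^*$,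 where $G$ is the connected and simply connected Lie group with Lie algebra $\mathfrak g=\mathfrak{sl}(2)$. Call such a space *infinite dimensional* if it is infinite dimensional over $\mathbb R$ and finitely generated neither over $S(\mathfrak g)^G$ nor over $\mathcal A(\mathfrak g)^G$. On $U=\{x_1^2+x_2^2-x_3^2>0\}$ use the parameters $(p,q,z)$, $z>0$, with $$x_1=-p\sin q+z\cos q,\quad x_2=-p\cos q-z\sin q,\quad x_3=p .$$ For $\alpha>\tfrac12$ put $$\hat t_\alpha=\frac1{(x_1^2+x_2^2+x_3^2)^{\alpha}},\qquad \hat k_\alpha=\frac{\exp\!\big(\frac{\alpha}{x_1^2+x_2^2+x_3^2}\big)}{(x_1^2+x_2^2+x_3^2)^2}.$$ Then: 1. $H^0_{\Lambda,tan}(\Omega)\cong I(\Omega)$, and $H^k_{\Lambda,tan}(\Omega)=0$ for all $k>2$. 2. (Limit obstructions.) (a) If $a,f\in C^\infty(\Omega)$ and $aH_{x_3}=\sigma f$, then for every $q$ the limit $\lim_{z\to0^+}\int_{-1}^1 a(s,q,z)\,ds$ exists in $\mathbb R$. (b) If $\varphi\in C^\infty(\Omega)$ is such that $\varphi|_U$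 depends only on $(p,z)$, and $\varphi\Lambda=\sigma(B)$ for some smooth tangential vector field $B$ on $\Omega$, then $\lim_{z\to0^+}\int_{-1}^1 2\pi\varphi(s,z)\,ds$ exists in $\mathbb R$. 3. (Degree 1.) For $\alpha>\frac12$, $\hat t_\alpha H_{x_3}$ and $\hat k_\alpha H_{x_3}$ are tangential $\sigma$-cocycles. The classes $[\hat t_\alpha H_{x_3}]$, $\alpha>\frac12$, in $H^1_{\Lambda,tan}(\Omega)$ are linearly independent over $\mathbb R$, and the classes $[\hat k_\alpha H_{x_3}]$, $\alpha>\frac12$, are linearly independent over $\mathbb R$, over $S(\mathfrak g)^G$ and over $\mathcal A(\mathfrak g)^G$. 4. (Degree 2.) For $\alpha>\frac12$, $\hat t_\alpha\Lambda$ and $\hat k_\alpha\Lambda$ are tangential $\sigma$-cocycles. The classes $[\hat t_\alpha\Lambda]$, $\alpha>\frac12$, in $H^2_{\Lambda,tan}(\Omega)$ are linearly independent over $\mathbb R$, and the classes $[\hat k_\alpha\Lambda]$, $\alpha>\frac12$, are linearly independent over $\mathbb R$, over $S(\mathfrak g)^G$ and over $\mathcal A(\mathfrak g)^G$. 5. $H^1_{\Lambda,tan}(\Omega)$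 and $H^2_{\Lambda,tan}(\Omega)$ are infinite dimensional. 6. $H^k_\Lambda(\Omega)$ is infinite dimensional for $1\le k\le3$. -/

import Mathlib

open scoped ContDiff Topology

noncomputable section

namespace PoissonTP

/-! ### Multivector fields on an open set of `ℝⁿ` -/

/-- `k`-vectors of `ℝⁿ`, seen as alternating `k`-linear forms on covectors
(covectors are identified with their coordinate vectors `Fin n → ℝ`). -/
abbrev MultiVec (n k : ℕ) : Type := (Fin n → ℝ) [⋀^Fin k]→ₗ[ℝ] ℝ

variable {n : ℕ} {Ω : TopologicalSpace.Opens (Fin n → ℝ)}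

/-- Extension by zero of a function on `Ω`; it only serves to differentiate at points of `Ω`. -/
def zeroExt (f : Ω → ℝ) : (Fin n → ℝ) → ℝ := Function.extend Subtype.val f 0

theorem zeroExt_apply (f : Ω → ℝ) (x : Ω) : zeroExt f x = f x :=
  Subtype.val_injective.extend_apply f 0 x

/-- `f ∈ C^∞(Ω)`. -/
def IsSmooth (f : Ω → ℝ) : Prop := ContDiffOn ℝ ∞ (zeroExt f) (Ω : Set (Fin n → ℝ))

/-- The differential of `f` at `x ∈ Ω`, as a covector. -/
def dCov (f : Ω → ℝ) (x : Ω) : Fin n → ℝ :=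
  fun i => fderiv ℝ (zeroExt f) (x : Fin n → ℝ) (Pi.single i 1)

/-- The ring of all real functions on `Ω`. -/
def FunRing (Ω : TopologicalSpace.Opens (Fin n → ℝ)) : Type := Ω → ℝ

instance : CommRing (FunRing Ω) := inferInstanceAs (CommRing (Ω → ℝ))

instance : Algebra ℝ (FunRing Ω) := inferInstanceAs (Algebra ℝ (Ω → ℝ))

/-- (Not necessarily smooth) `k`-vector fields on `Ω`, with pointwise operations; functions on `Ω`
act by pointwise multiplication. -/
def MVField (Ω : TopologicalSpace.Opens (Fin n → ℝ)) (k : ℕ) : Type := Ω → MultiVec n k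

instance (k : ℕ) : AddCommGroup (MVField Ω k) := inferInstanceAs (AddCommGroup (Ω → MultiVec n k))

instance (k : ℕ) : Module ℝ (MVField Ω k) := inferInstanceAs (Module ℝ (Ω → MultiVec n k))

instance (k : ℕ) : Module (FunRing Ω) (MVField Ω k) where
  smul f Q := fun x => f x • Q x
  one_smul Q := funext fun x => one_smul ℝ (Q x)
  mul_smul f g Q := funext fun x => mul_smul (f x) (g x) (Q x)
  smul_zero f := funext fun x => smul_zero (f x)
  smul_add f Q Q' := funext fun x => smul_add (f x) (Q x) (Q' x)
  add_smul f g Q := funext fun x => add_smul (f x) (g x) (Q x)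
  zero_smul Q := funext fun x => zero_smul ℝ (Q x)

instance (k : ℕ) : IsScalarTower ℝ (FunRing Ω) (MVField Ω k) :=
  ⟨fun r f Q => funext fun x => mul_smul r (f x) (Q x)⟩

theorem MVField.add_apply {k : ℕ} (Q Q' : MVField Ω k) (x : Ω) (ξ : Fin k → (Fin n → ℝ)) :
    (Q + Q') x ξ = Q x ξ + Q' x ξ := rfl

theorem MVField.smul_apply {k : ℕ} (f : FunRing Ω) (Q : MVField Ω k) (x : Ω)
    (ξ : Fin k → (Fin n → ℝ)) :
    (f • Q) x ξ = f x * Q x ξ := rfl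

/-- A `k`-vector field is smooth when all its components are. -/
def IsSmoothField {k : ℕ} (Q : MVField Ω k) : Prop :=
  ∀ ξ : Fin k → (Fin n → ℝ), IsSmooth (fun x => Q x ξ)

theorem IsSmooth.differentiableAt {f : Ω → ℝ} (hf : IsSmooth f) (x : Ω) :
    DifferentiableAt ℝ (zeroExt f) (x : Fin n → ℝ) :=
  (hf.contDiffAt (Ω.isOpen.mem_nhds x.2)).differentiableAt (by simp)

theorem zeroExt_congr_on {f : Ω → ℝ} {F : (Fin n → ℝ) → ℝ} (h : ∀ x : Ω, f x = F x) :
    Set.EqOn (zeroExt f) F (Ω : Set (Fin n → ℝ)) := fun x hx => by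
  have := zeroExt_apply f ⟨x, hx⟩
  simp only at this
  rw [this, h]

theorem isSmooth_of_eq {f : Ω → ℝ} {F : (Fin n → ℝ) → ℝ}
    (hF : ContDiffOn ℝ ∞ F (Ω : Set (Fin n → ℝ))) (h : ∀ x : Ω, f x = F x) : IsSmooth f :=
  hF.congr (zeroExt_congr_on h)

theorem diff_of_eq {f : Ω → ℝ} {F : (Fin n → ℝ) → ℝ} (h : ∀ x : Ω, f x = F x) (x : Ω) :
    dCov f x = fun i => fderiv ℝ F (x : Fin n → ℝ) (Pi.single i 1) := by
  have : zeroExt f =ᶠ[𝓝 (x : Fin n → ℝ)] F :=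
    (zeroExt_congr_on h).eventuallyEq_of_mem (Ω.isOpen.mem_nhds x.2)
  funext i
  rw [dCov, this.fderiv_eq]

theorem IsSmooth.const (r : ℝ) : IsSmooth (fun _ : Ω => r) :=
  isSmooth_of_eq (F := fun _ => r) contDiffOn_const fun _ => rfl

theorem IsSmooth.add {f g : Ω → ℝ} (hf : IsSmooth f) (hg : IsSmooth g) :
    IsSmooth (fun x => f x + g x) :=
  isSmooth_of_eq (F := fun y => zeroExt f y + zeroExt g y) (ContDiffOn.add hf hg)
    fun x => by rw [zeroExt_apply, zeroExt_apply]

theorem IsSmooth.mul {f g : Ω → ℝ} (hf : IsSmooth f) (hg : IsSmooth g) :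
    IsSmooth (fun x => f x * g x) :=
  isSmooth_of_eq (F := fun y => zeroExt f y * zeroExt g y) (ContDiffOn.mul hf hg)
    fun x => by rw [zeroExt_apply, zeroExt_apply]

theorem diff_const (r : ℝ) (x : Ω) : dCov (fun _ : Ω => r) x = 0 := by
  rw [diff_of_eq (F := fun _ => r) fun _ => rfl]
  funext i
  simp

theorem diff_add {f g : Ω → ℝ} (hf : IsSmooth f) (hg : IsSmooth g) (x : Ω) :
    dCov (fun y => f y + g y) x = dCov f x + dCov g x := by
  rw [diff_of_eq (F := zeroExt f + zeroExt g) fun x => by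
    rw [Pi.add_apply, zeroExt_apply, zeroExt_apply]]
  funext i
  rw [fderiv_add (hf.differentiableAt x) (hg.differentiableAt x)]
  rfl

theorem diff_mul {f g : Ω → ℝ} (hf : IsSmooth f) (hg : IsSmooth g) (x : Ω) :
    dCov (fun y => f y * g y) x = f x • dCov g x + g x • dCov f x := by
  rw [diff_of_eq (F := zeroExt f * zeroExt g) fun x => by
    rw [Pi.mul_apply, zeroExt_apply, zeroExt_apply]]
  funext i
  rw [fderiv_mul (hf.differentiableAt x) (hg.differentiableAt x)]
  simp [zeroExt_apply, dCov]

/-! ### The Poisson coboundary operator of a bivector field `Λ` -/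

/-- The Hamiltonian vector field `H_f = {f, ·}`, i.e. `H_f(ξ) = Λ(df, ξ)`. -/
def ham (Λ : MVField Ω 2) (f : Ω → ℝ) (x : Ω) : MultiVec n 1 :=
  (Λ x).curryLeft (dCov f x)

/-- `ξ^#(f)` at `x`, for a covector `ξ`, where `ξ^#(η) = Λ(ξ, η)`. -/
def sharpDeriv (Λ : MVField Ω 2) (ξ : Fin n → ℝ) (f : Ω → ℝ) (x : Ω) : ℝ :=
  Λ x ![ξ, dCov f x]

/-- The bracket `{ξ, η}` at `x` of two constant `1`-forms `ξ, η`; these are exact, so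
`{ξ, η} = d(Λ(ξ, η))`. -/
def formBracket (Λ : MVField Ω 2) (ξ η : Fin n → ℝ) (x : Ω) : Fin n → ℝ :=
  dCov (fun y => Λ y ![ξ, η]) x

/-- The second sum `∑_{i<j} (-1)^{i+j} Q({ξᵢ,ξⱼ}, ξ₀, …, ξ̂ᵢ, …, ξ̂ⱼ, …, ξₖ)` in the formula
for `σ Q`; here `j = m + 1` with `i ≤ m`, and the sum is empty for `k = 0`. -/
def bracketTerm (Λ : MVField Ω 2) : {k : ℕ} → (MVField Ω k) → Ω →
    (Fin (k + 1) → (Fin n → ℝ)) → ℝ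
  | 0, _, _, _ => 0
  | k + 1, Q, x, ξ => ∑ i : Fin (k + 2), ∑ m : Fin (k + 1),
      if (i : ℕ) ≤ m then
        (-1 : ℝ) ^ ((i : ℕ) + m + 1) *
          Q x (Fin.cons (formBracket Λ (ξ i) (ξ m.succ) x) (m.removeNth (i.removeNth ξ)))
      else 0

/-- The value at `x`, on the covectors `ξ₀, …, ξₖ`, of `σ Q = [Λ, Q]`
(Schouten bracket), for a `k`-vector field `Q`:
`∑ᵢ (-1)ⁱ ξᵢ^#(Q(ξ₀, …, ξ̂ᵢ, …, ξₖ)) + ∑_{i<j} (-1)^{i+j} Q({ξᵢ,ξⱼ}, …, ξ̂ᵢ, …, ξ̂ⱼ, …)`.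
By tensoriality it is enough to evaluate on constant `1`-forms. -/
def sigma (Λ : MVField Ω 2) {k : ℕ} (Q : MVField Ω k) (x : Ω)
    (ξ : Fin (k + 1) → (Fin n → ℝ)) : ℝ :=
  (∑ i : Fin (k + 1), (-1 : ℝ) ^ (i : ℕ) *
    sharpDeriv Λ (ξ i) (fun y => Q y (i.removeNth ξ)) x) + bracketTerm Λ Q x ξ

/-- `P = σ Q` on `Ω`. -/
def IsSigma (Λ : MVField Ω 2) {k : ℕ} (Q : MVField Ω k)
    (P : MVField Ω (k + 1)) : Prop :=
  ∀ (x : Ω) (ξ : Fin (k + 1) → (Fin n → ℝ)), P x ξ = sigma Λ Q x ξ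

/-- A multivector field is tangential (a section of `⋀ᵏ(T𝓕)`, with `T𝓕` the image of `#`) when it
vanishes as soon as one of its arguments lies in the annihilator of `T𝓕`. -/
def IsTangential (Λ : MVField Ω 2) {k : ℕ} (Q : MVField Ω k) : Prop :=
  ∀ (x : Ω) (ξ : Fin k → (Fin n → ℝ)),
    (∃ i, ∀ η : Fin n → ℝ, Λ x ![η, ξ i] = 0) → Q x ξ = 0

/-- The algebra `I(Ω)` of Casimir functions: smooth functions with trivial Hamiltonian field. -/
def casimirs (Λ : MVField Ω 2) : Subalgebra ℝ (FunRing Ω) where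
  carrier := {f | IsSmooth f ∧ ∀ x, ham Λ f x = 0}
  mul_mem' := by
    rintro f g ⟨hf, hf'⟩ ⟨hg, hg'⟩
    refine ⟨hf.mul hg, fun x => ?_⟩
    have h := diff_mul hf hg x
    change (Λ x).curryLeft (dCov (fun y => f y * g y) x) = 0
    have h1 := hf' x
    have h2 := hg' x
    unfold ham at h1 h2
    rw [h, map_add, map_smul, map_smul, h1, h2, smul_zero, smul_zero, add_zero]
  add_mem' := by
    rintro f g ⟨hf, hf'⟩ ⟨hg, hg'⟩
    refine ⟨hf.add hg, fun x => ?_⟩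
    have h := diff_add hf hg x
    change (Λ x).curryLeft (dCov (fun y => f y + g y) x) = 0
    have h1 := hf' x
    have h2 := hg' x
    unfold ham at h1 h2
    rw [h, map_add, h1, h2, add_zero]
  algebraMap_mem' := by
    intro r
    refine ⟨IsSmooth.const r, fun x => ?_⟩
    change (Λ x).curryLeft (dCov (fun _ => r) x) = 0
    rw [diff_const, map_zero]

theorem lambda_skew {Λ : MVField Ω 2} (x : Ω) (ξ η : Fin n → ℝ) :
    Λ x ![ξ, η] = - Λ x ![η, ξ] := by
  have h := (Λ x).map_swap ![η, ξ] (i := 0) (j := 1) (by decide)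
  rw [← h]
  congr 1
  funext i
  fin_cases i <;> simp

theorem sharpDeriv_casimir {Λ : MVField Ω 2} {c : FunRing Ω} (hc : c ∈ casimirs Λ)
    (ξ : Fin n → ℝ) (x : Ω) : sharpDeriv Λ ξ c x = 0 := by
  have h : Λ x ![dCov c x, ξ] = 0 := by
    have := congrArg (fun q : MultiVec n 1 => q ![ξ]) (hc.2 x)
    simpa [ham] using this
  change Λ x ![ξ, dCov c x] = 0
  rw [lambda_skew, h, neg_zero]

theorem lambda_add (L : MultiVec n 2) (ξ η η' : Fin n → ℝ) :
    L ![ξ, η + η'] = L ![ξ, η] + L ![ξ, η'] := by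
  exact congrArg (fun q : MultiVec n 0 => q ![]) ((L.curryLeft ξ).curryLeft.map_add η η')

theorem lambda_smul (L : MultiVec n 2) (ξ η : Fin n → ℝ) (r : ℝ) :
    L ![ξ, r • η] = r * L ![ξ, η] := by
  exact congrArg (fun q : MultiVec n 0 => q ![]) ((L.curryLeft ξ).curryLeft.map_smul r η)

theorem bracketTerm_add (Λ : MVField Ω 2) {k : ℕ} (Q Q' : MVField Ω k) (x : Ω)
    (ξ : Fin (k + 1) → (Fin n → ℝ)) :
    bracketTerm Λ (Q + Q') x ξ = bracketTerm Λ Q x ξ + bracketTerm Λ Q' x ξ := by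
  cases k with
  | zero => simp [bracketTerm]
  | succ k =>
    simp only [bracketTerm, ← Finset.sum_add_distrib]
    refine Finset.sum_congr rfl fun i _ => Finset.sum_congr rfl fun m _ => ?_
    split_ifs
    · rw [MVField.add_apply, mul_add]
    · rw [add_zero]

theorem bracketTerm_smul (Λ : MVField Ω 2) {k : ℕ} (c : Ω → ℝ) (Q : MVField Ω k)
    (x : Ω) (ξ : Fin (k + 1) → (Fin n → ℝ)) :
    bracketTerm Λ (fun y => c y • Q y) x ξ = c x * bracketTerm Λ Q x ξ := by
  cases k with
  | zero => simp [bracketTerm]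
  | succ k =>
    simp only [bracketTerm, Finset.mul_sum]
    refine Finset.sum_congr rfl fun i _ => Finset.sum_congr rfl fun m _ => ?_
    split_ifs
    · rw [AlternatingMap.smul_apply, smul_eq_mul]; ring
    · rw [mul_zero]

theorem sigma_add (Λ : MVField Ω 2) {k : ℕ} {Q Q' : MVField Ω k}
    (hQ : IsSmoothField Q) (hQ' : IsSmoothField Q') (x : Ω) (ξ : Fin (k + 1) → (Fin n → ℝ)) :
    sigma Λ (Q + Q') x ξ = sigma Λ Q x ξ + sigma Λ Q' x ξ := by
  have h : ∀ i : Fin (k + 1), sharpDeriv Λ (ξ i) (fun y => (Q + Q') y (i.removeNth ξ)) x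
      = sharpDeriv Λ (ξ i) (fun y => Q y (i.removeNth ξ)) x
        + sharpDeriv Λ (ξ i) (fun y => Q' y (i.removeNth ξ)) x := by
    intro i
    have hd := diff_add (hQ (i.removeNth ξ)) (hQ' (i.removeNth ξ)) x
    change Λ x ![ξ i, dCov (fun y => Q y (i.removeNth ξ) + Q' y (i.removeNth ξ)) x] = _
    rw [hd, lambda_add]
    rfl
  simp only [sigma, h, bracketTerm_add, mul_add, Finset.sum_add_distrib]
  ring

theorem sigma_smul {Λ : MVField Ω 2} {k : ℕ} {c : FunRing Ω} (hc : c ∈ casimirs Λ)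
    {Q : MVField Ω k} (hQ : IsSmoothField Q) (x : Ω) (ξ : Fin (k + 1) → (Fin n → ℝ)) :
    sigma Λ (fun y => c y • Q y) x ξ = c x * sigma Λ Q x ξ := by
  have h : ∀ i : Fin (k + 1), sharpDeriv Λ (ξ i) (fun y => (c y • Q y) (i.removeNth ξ)) x
      = c x * sharpDeriv Λ (ξ i) (fun y => Q y (i.removeNth ξ)) x := by
    intro i
    have hd := diff_mul hc.1 (hQ (i.removeNth ξ)) x
    change Λ x ![ξ i, dCov (fun y => c y * Q y (i.removeNth ξ)) x] = _
    have h0 := sharpDeriv_casimir hc (ξ i) x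
    unfold sharpDeriv at h0 ⊢
    rw [hd, lambda_add, lambda_smul, lambda_smul, h0, mul_zero, add_zero]
  have hb := bracketTerm_smul Λ c Q x ξ
  simp only [sigma, h, mul_add, Finset.mul_sum]
  refine congrArg₂ (· + ·) ?_ hb
  refine Finset.sum_congr rfl fun i _ => ?_
  ring

/-- `𝒱ᵏ(Ω)`, the `I(Ω)`-module of smooth `k`-vector fields on `Ω`. -/
def fields (Λ : MVField Ω 2) (k : ℕ) : Submodule (casimirs Λ) (MVField Ω k) where
  carrier := {Q | IsSmoothField Q}
  add_mem' := fun hQ hQ' ξ => (hQ ξ).add (hQ' ξ)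
  zero_mem' := fun _ => IsSmooth.const 0
  smul_mem' := fun c _ hQ ξ => c.2.1.mul (hQ ξ)

/-- `𝒱_{0,k}(Ω)`, the `I(Ω)`-module of smooth tangential `k`-vector fields on `Ω`. -/
def tangentialFields (Λ : MVField Ω 2) (k : ℕ) :
    Submodule (casimirs Λ) (MVField Ω k) where
  carrier := {Q | IsSmoothField Q ∧ IsTangential Λ Q}
  add_mem' := fun hQ hQ' => ⟨fun ξ => (hQ.1 ξ).add (hQ'.1 ξ), fun x ξ h => by
    rw [MVField.add_apply, hQ.2 x ξ h, hQ'.2 x ξ h, add_zero]⟩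
  zero_mem' := ⟨fun _ => IsSmooth.const 0, fun _ _ _ => rfl⟩
  smul_mem' := fun c Q hQ => ⟨fun ξ => c.2.1.mul (hQ.1 ξ), fun x ξ h => by
    change c.1 x • Q x ξ = 0
    rw [hQ.2 x ξ h, smul_zero]⟩

/-- Smooth `k`-vector fields `Q` with `σ Q = 0`. -/
def sigmaKer (Λ : MVField Ω 2) (k : ℕ) : Submodule (casimirs Λ) (MVField Ω k) where
  carrier := {Q | IsSmoothField Q ∧ IsSigma Λ Q 0}
  add_mem' := fun {Q Q'} hQ hQ' => ⟨fun ξ => (hQ.1 ξ).add (hQ'.1 ξ), fun x ξ => by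
    rw [sigma_add Λ hQ.1 hQ'.1, ← hQ.2 x ξ, ← hQ'.2 x ξ]
    exact (add_zero (0 : ℝ)).symm⟩
  zero_mem' := ⟨fun _ => IsSmooth.const 0, fun x ξ => by
    have h0 : IsSmoothField (0 : MVField Ω k) := fun _ => IsSmooth.const 0
    have h := sigma_add Λ h0 h0 x ξ
    rw [add_zero] at h
    have h' : sigma Λ (0 : MVField Ω k) x ξ = 0 := by linarith
    rw [h']
    rfl⟩
  smul_mem' := fun c Q hQ => ⟨fun ξ => c.2.1.mul (hQ.1 ξ), fun x ξ => by
    have h := sigma_smul c.2 hQ.1 x ξ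
    change (0 : ℝ) = sigma Λ (fun y => c.1 y • Q y) x ξ
    rw [h, ← hQ.2 x ξ]
    exact (mul_zero (c.1 x)).symm⟩

/-- The image under `σ` of the smooth `k`-vector fields that belong to `C`. -/
def sigmaImage (Λ : MVField Ω 2) {k : ℕ}
    (C : Submodule (casimirs Λ) (MVField Ω k)) :
    Submodule (casimirs Λ) (MVField Ω (k + 1)) where
  carrier := {P | ∃ Q ∈ C, IsSmoothField Q ∧ IsSigma Λ Q P}
  add_mem' := by
    rintro P P' ⟨Q, hQC, hQ, h⟩ ⟨Q', hQC', hQ', h'⟩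
    refine ⟨Q + Q', C.add_mem hQC hQC', fun ξ => (hQ ξ).add (hQ' ξ), fun x ξ => ?_⟩
    rw [sigma_add Λ hQ hQ', ← h x ξ, ← h' x ξ]
    rfl
  zero_mem' := ⟨0, C.zero_mem, (sigmaKer Λ k).zero_mem.1, (sigmaKer Λ k).zero_mem.2⟩
  smul_mem' := by
    rintro c P ⟨Q, hQC, hQ, h⟩
    refine ⟨c • Q, C.smul_mem c hQC, fun ξ => c.2.1.mul (hQ ξ), fun x ξ => ?_⟩
    have h1 := sigma_smul c.2 hQ x ξ
    change c.1 x * P x ξ = sigma Λ (fun y => c.1 y • Q y) x ξ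
    rw [h1, h x ξ]

/-- Degree `k` coboundaries `σ(C^{k-1}) ∩ Cᵏ` of the complex `(C, σ)`. -/
def coboundaries (Λ : MVField Ω 2)
    (C : (k : ℕ) → Submodule (casimirs Λ) (MVField Ω k)) :
    (k : ℕ) → Submodule (casimirs Λ) (MVField Ω k)
  | 0 => ⊥
  | k + 1 => C (k + 1) ⊓ sigmaImage Λ (C k)

/-- Degree `k` cocycles of the complex `(C, σ)`. -/
abbrev cocycles (Λ : MVField Ω 2)
    (C : (k : ℕ) → Submodule (casimirs Λ) (MVField Ω k)) (k : ℕ) :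
    Submodule (casimirs Λ) (MVField Ω k) := C k ⊓ sigmaKer Λ k

/-- Degree `k` cohomology, an `I(Ω)`-module, of the complex `(C, σ)`. -/
def Cohomology (Λ : MVField Ω 2)
    (C : (k : ℕ) → Submodule (casimirs Λ) (MVField Ω k)) (k : ℕ) : Type :=
  (cocycles Λ C k) ⧸ (coboundaries Λ C k).submoduleOf (cocycles Λ C k)

section

variable (Λ : MVField Ω 2) (C : (k : ℕ) → Submodule (casimirs Λ) (MVField Ω k)) (k : ℕ)

instance : AddCommGroup (Cohomology Λ C k) :=
  inferInstanceAs (AddCommGroup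
    ((cocycles Λ C k) ⧸ (coboundaries Λ C k).submoduleOf (cocycles Λ C k)))

instance : Module (casimirs Λ) (Cohomology Λ C k) :=
  inferInstanceAs (Module (casimirs Λ)
    ((cocycles Λ C k) ⧸ (coboundaries Λ C k).submoduleOf (cocycles Λ C k)))

/-- Real scalars act as constant Casimir functions. -/
instance : Module ℝ (Cohomology Λ C k) := Module.compHom _ (algebraMap ℝ (casimirs Λ))

instance : IsScalarTower ℝ (casimirs Λ) (Cohomology Λ C k) :=
  ⟨fun r c h => by
    rw [Algebra.smul_def, mul_smul]
    rfl⟩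

end

/-- The P-cohomology `Hᵏ_Λ(Ω)`. -/
abbrev HP (Λ : MVField Ω 2) (k : ℕ) : Type := Cohomology Λ (fields Λ) k

/-- The TP-cohomology `Hᵏ_{Λ,tan}(Ω)` (on tangential fields, `σ'' = σ`). -/
abbrev HTan (Λ : MVField Ω 2) (k : ℕ) : Type := Cohomology Λ (tangentialFields Λ) k

/-- The class in `Hᵏ_{Λ,tan}(Ω)` of a tangential cocycle. -/
def tanClass (Λ : MVField Ω 2) (k : ℕ) (Q : cocycles Λ (tangentialFields Λ) k) : HTan Λ k :=
  ((coboundaries Λ (tangentialFields Λ) k).submoduleOf (cocycles Λ (tangentialFields Λ) k)).mkQ Q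

/-- A function, as a `0`-vector field. -/
def ofFun (f : Ω → ℝ) : MVField Ω 0 :=
  fun x => AlternatingMap.constOfIsEmpty ℝ (Fin n → ℝ) (Fin 0) (f x)

/-! ### The Lie algebra `sl(2)` and its dual -/

/-- The bracket of `sl(2)` in the basis `X₁, X₂, X₃` (indices `0, 1, 2`) with
`[X₁, X₂] = -X₃`, `[X₃, X₁] = X₂`, `[X₃, X₂] = -X₁`. -/
def slBracket (ξ η : Fin 3 → ℝ) : Fin 3 → ℝ :=
  ![ξ 1 * η 2 - ξ 2 * η 1, ξ 2 * η 0 - ξ 0 * η 2, -(ξ 0 * η 1 - ξ 1 * η 0)]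

/-- `Ω = sl(2)^* \ {0}`, in the coordinates dual to `X₁, X₂, X₃`. -/
def slΩ : TopologicalSpace.Opens (Fin 3 → ℝ) := ⟨{0}ᶜ, isOpen_compl_singleton⟩

/-- The linear Poisson structure `Λ_x(ξ, η) = ⟨x, [ξ, η]⟩` on `Ω`. -/
def slΛ : MVField slΩ 2 := fun x => {
  toFun v := (x : Fin 3 → ℝ) ⬝ᵥ slBracket (v 0) (v 1)
  map_update_add' := by
    intro inst v i a b
    rw [Subsingleton.elim inst (instDecidableEqFin 2)]
    fin_cases i <;> simp [slBracket, dotProduct, Fin.sum_univ_three] <;> ring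
  map_update_smul' := by
    intro inst v i c a
    rw [Subsingleton.elim inst (instDecidableEqFin 2)]
    fin_cases i <;> simp [slBracket, dotProduct, Fin.sum_univ_three] <;> ring
  map_eq_zero_of_eq' := by
    intro v i j h hij
    have h01 : v 0 = v 1 := by
      fin_cases i <;> fin_cases j <;> simp_all
    simp [slBracket, dotProduct, Fin.sum_univ_three, h01]
    ring }

/-- The infinitesimal coadjoint action, `⟨ad*_X μ, Y⟩ = -⟨μ, [X, Y]⟩`. -/
def coad (X : Fin 3 → ℝ) : (Fin 3 → ℝ) →L[ℝ] (Fin 3 → ℝ) :=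
  LinearMap.toContinuousLinearMap
    { toFun := fun μ i => -(μ ⬝ᵥ slBracket X (Pi.single i 1))
      map_add' := fun μ ν => by
        funext i
        simp only [add_dotProduct, Pi.add_apply]
        ring
      map_smul' := fun c μ => by
        funext i
        simp }

/-- Invariance under the coadjoint action of the connected group `G` with Lie algebra `sl(2)`
(`G` is generated by the elements `exp X`, and `Ad*(exp X) = exp(ad*_X)`). -/
def IsGInvariant (F : (Fin 3 → ℝ) → ℝ) : Prop :=
  ∀ (X μ : Fin 3 → ℝ), F (NormedSpace.exp (coad X) μ) = F μ

/-- `S(g)^G`: (restrictions to `Ω` of) `G`-invariant polynomial functions on `sl(2)^*`. -/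
def invPoly : Subalgebra ℝ (casimirs slΛ) where
  carrier := {c | ∃ p : MvPolynomial (Fin 3) ℝ,
    IsGInvariant (fun μ => MvPolynomial.eval μ p) ∧ ∀ x : slΩ, c.1 x = MvPolynomial.eval x.1 p}
  mul_mem' := by
    rintro c c' ⟨p, hp, h⟩ ⟨p', hp', h'⟩
    refine ⟨p * p', fun X μ => ?_, fun x => ?_⟩
    · simpa using congrArg₂ (· * ·) (hp X μ) (hp' X μ)
    · exact (congrArg₂ (· * ·) (h x) (h' x)).trans (map_mul (MvPolynomial.eval x.1) p p').symm
  add_mem' := by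
    rintro c c' ⟨p, hp, h⟩ ⟨p', hp', h'⟩
    refine ⟨p + p', fun X μ => ?_, fun x => ?_⟩
    · simpa using congrArg₂ (· + ·) (hp X μ) (hp' X μ)
    · exact (congrArg₂ (· + ·) (h x) (h' x)).trans (map_add (MvPolynomial.eval x.1) p p').symm
  algebraMap_mem' r := ⟨MvPolynomial.C r, fun X μ => by simp,
    fun x => (MvPolynomial.eval_C r).symm⟩

/-- `A(g)^G`: (restrictions to `Ω` of) `G`-invariant real-analytic functions on `sl(2)^*`. -/
def invAnalytic : Subalgebra ℝ (casimirs slΛ) where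
  carrier := {c | ∃ F : (Fin 3 → ℝ) → ℝ, AnalyticOnNhd ℝ F Set.univ ∧
    IsGInvariant F ∧ ∀ x : slΩ, c.1 x = F x.1}
  mul_mem' := by
    rintro c c' ⟨p, hpa, hp, h⟩ ⟨p', hpa', hp', h'⟩
    refine ⟨p * p', hpa.mul hpa', fun X μ => ?_, fun x => ?_⟩
    · exact congrArg₂ (· * ·) (hp X μ) (hp' X μ)
    · exact congrArg₂ (· * ·) (h x) (h' x)
  add_mem' := by
    rintro c c' ⟨p, hpa, hp, h⟩ ⟨p', hpa', hp', h'⟩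
    refine ⟨p + p', hpa.add hpa', fun X μ => ?_, fun x => ?_⟩
    · exact congrArg₂ (· + ·) (hp X μ) (hp' X μ)
    · exact congrArg₂ (· + ·) (h x) (h' x)
  algebraMap_mem' r := ⟨fun _ => r, analyticOnNhd_const, fun X μ => rfl, fun x => rfl⟩

/-- Infinite dimensional over `ℝ`, and not finitely generated over `S(g)^G` nor `A(g)^G`. -/
def IsInfiniteDim (H : Type) [AddCommGroup H] [Module ℝ H] [Module (casimirs slΛ) H] : Prop :=
  ¬ Module.Finite ℝ H ∧ ¬ Module.Finite invPoly H ∧ ¬ Module.Finite invAnalytic H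

/-- `x₁² + x₂² + x₃²`. -/
def normSq3 (x : Fin 3 → ℝ) : ℝ := x 0 ^ 2 + x 1 ^ 2 + x 2 ^ 2

/-- `t̂_α = (x₁² + x₂² + x₃²)^{-α}`. -/
def tHat (α : ℝ) (x : slΩ) : ℝ := 1 / normSq3 x.1 ^ α

/-- `k̂_α = exp(α / (x₁² + x₂² + x₃²)) / (x₁² + x₂² + x₃²)²`. -/
def kHat (α : ℝ) (x : slΩ) : ℝ := Real.exp (α / normSq3 x.1) / normSq3 x.1 ^ 2

/-- The vector field `a H_{x₃}`. -/
def aH3 (a : slΩ → ℝ) : MVField slΩ 1 := fun x => a x • ham slΛ (fun y => y.1 2) x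

/-- The bivector field `φ Λ`. -/
def mulΛ (φ : slΩ → ℝ) : MVField slΩ 2 := fun x => φ x • slΛ x

/-- For `z > 0`, the parameterization of `{x₁² + x₂² - x₃² > 0}` (with
`x₁² + x₂² - x₃² = z²`, `x₃ = p`). -/
def param (p q z : ℝ) : Fin 3 → ℝ :=
  ![-p * Real.sin q + z * Real.cos q, -p * Real.cos q - z * Real.sin q, p]

end PoissonTP

end

/-!
The leaf `x₁² + x₂² - x₃² = z²`, `z > 0`, is a cylinder with coordinates `(p, q)`. If
`a H_{x₃} = σ f` then `a = -∂f/∂p` on it, so the integral of `a` over an arc `|p| ≤ 1` is a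
difference of boundary values of `f`. As `z → 0⁺` the arc runs into the removed origin, but its end
points stay in `Ω`, so the integral converges although `a` may blow up in the middle. In degree 2,
averaging over the angle `q` gives the same conclusion by Stokes' theorem, and contraction with
`d(x₁² + x₂² - x₃²)` reduces degree 3 to degree 2.

On the arc `x₁² + x₂² + x₃² = 2p² + z²`, so the integrals of `t̂_α` and `k̂_α` diverge as
`z → 0⁺`, at a rate that increases strictly with `α`. A Casimir coefficient is a function of `z`
alone, and if it is the restriction of an analytic function, it is zero or bounded below by a power
of `z`. Since `k̂_α` gains more than every power of `z` when `α` grows, the term of largest `α` with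
a nonzero coefficient dominates any linear relation, against the convergence of the integral.
-/

noncomputable section

namespace PoissonTP

section General

variable {n : ℕ} {Ω : TopologicalSpace.Opens (Fin n → ℝ)}

/-! ### Smooth functions and multivector fields -/

theorem zeroExt_of_mem (f : Ω → ℝ) {y : Fin n → ℝ} (hy : y ∈ Ω) : zeroExt f y = f ⟨y, hy⟩ :=
  zeroExt_apply f ⟨y, hy⟩

theorem IsSmooth.sum {ι : Type*} (s : Finset ι) {f : ι → Ω → ℝ} (hf : ∀ i ∈ s, IsSmooth (f i)) :
    IsSmooth (fun x => ∑ i ∈ s, f i x) :=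
  isSmooth_of_eq (F := fun y => ∑ i ∈ s, zeroExt (f i) y) (ContDiffOn.sum hf)
    fun x => by simp only [zeroExt_apply]

theorem dCov_sum {ι : Type*} (s : Finset ι) {f : ι → Ω → ℝ} (hf : ∀ i ∈ s, IsSmooth (f i))
    (x : Ω) : dCov (fun y => ∑ i ∈ s, f i y) x = ∑ i ∈ s, dCov (f i) x := by
  classical
  induction s using Finset.induction_on with
  | empty => simp only [Finset.sum_empty, diff_const]
  | insert i s hi ih =>
    obtain ⟨hfi, hfs⟩ := Finset.forall_mem_insert .. |>.mp hf
    simp only [Finset.sum_insert hi, diff_add hfi (IsSmooth.sum s hfs), ih hfs]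

theorem IsSmooth.neg {f : Ω → ℝ} (hf : IsSmooth f) : IsSmooth (fun x => -f x) := by
  simpa only [neg_one_mul] using (IsSmooth.const (-1)).mul hf

theorem dCov_neg {f : Ω → ℝ} (hf : IsSmooth f) (x : Ω) :
    dCov (fun y => -f y) x = -dCov f x := by
  have h := diff_mul (IsSmooth.const (-1)) hf x
  simpa only [neg_one_mul, diff_const, smul_zero, add_zero, neg_one_smul] using h

theorem dCov_mul_const {f : Ω → ℝ} (hf : IsSmooth f) (r : ℝ) (x : Ω) :
    dCov (fun y => f y * r) x = r • dCov f x := by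
  rw [diff_mul hf (IsSmooth.const r), diff_const, smul_zero, zero_add]

theorem dCov_dotProduct (v : Fin n → ℝ) (x : Ω) :
    dCov (fun y : Ω => (y : Fin n → ℝ) ⬝ᵥ v) x = v := by
  let L : (Fin n → ℝ) →L[ℝ] ℝ := (dotProductBilin ℝ ℝ v).toContinuousLinearMap
  rw [diff_of_eq (F := L) fun y => dotProduct_comm _ _]
  funext i
  rw [L.fderiv]
  exact dotProduct_single_one v i

theorem isSmooth_dotProduct (v : Fin n → ℝ) : IsSmooth (fun y : Ω => (y : Fin n → ℝ) ⬝ᵥ v) := by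
  refine isSmooth_of_eq (F := fun y => y ⬝ᵥ v) (ContDiff.contDiffOn ?_) fun _ => rfl
  unfold dotProduct
  fun_prop

theorem dCov_coord (i : Fin n) (x : Ω) :
    dCov (fun y : Ω => (y : Fin n → ℝ) i) x = Pi.single i 1 := by
  simpa only [dotProduct_single_one] using dCov_dotProduct (Pi.single i 1) x

theorem isSmooth_coord (i : Fin n) : IsSmooth (fun y : Ω => (y : Fin n → ℝ) i) := by
  simpa only [dotProduct_single_one] using isSmooth_dotProduct (Ω := Ω) (Pi.single i 1)

theorem hasDerivAt_zeroExt_comp {f : Ω → ℝ} (hf : IsSmooth f) {γ : ℝ → Fin n → ℝ}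
    {γ' : Fin n → ℝ} {t : ℝ} (ht : γ t ∈ Ω) (hγ : HasDerivAt γ γ' t) :
    HasDerivAt (fun s => zeroExt f (γ s)) (dCov f ⟨γ t, ht⟩ ⬝ᵥ γ') t := by
  have hcoord : dCov f ⟨γ t, ht⟩ ⬝ᵥ γ' = fderiv ℝ (zeroExt f) (γ t) γ' := by
    nth_rw 2 [pi_eq_sum_univ' γ']
    simp only [map_sum, map_smul, dotProduct, dCov, smul_eq_mul, mul_comm]
  rw [hcoord]
  exact (hf.differentiableAt ⟨γ t, ht⟩).hasFDerivAt.comp_hasDerivAt t hγ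

theorem IsSmooth.comp {ψ : ℝ → ℝ} {s : Set ℝ} (hψ : ContDiffOn ℝ ∞ ψ s) {f : Ω → ℝ}
    (hf : IsSmooth f) (hs : ∀ x, f x ∈ s) : IsSmooth (fun x => ψ (f x)) := by
  refine isSmooth_of_eq (F := ψ ∘ zeroExt f) (ContDiffOn.comp hψ hf fun y hy => ?_)
    fun x => by rw [Function.comp_apply, zeroExt_apply]
  rw [zeroExt_of_mem f hy]
  exact hs _

theorem dCov_comp {ψ : ℝ → ℝ} {f : Ω → ℝ} (hf : IsSmooth f) {x : Ω}
    (hψ : DifferentiableAt ℝ ψ (f x)) :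
    dCov (fun y => ψ (f y)) x = deriv ψ (f x) • dCov f x := by
  rw [← zeroExt_apply f x] at hψ
  rw [diff_of_eq (F := ψ ∘ zeroExt f) fun y => by rw [Function.comp_apply, zeroExt_apply],
    (hψ.hasDerivAt.comp_hasFDerivAt _ (hf.differentiableAt x).hasFDerivAt).fderiv, zeroExt_apply]
  rfl

theorem IsSmooth.continuous_dCov {f : Ω → ℝ} (hf : IsSmooth f) : Continuous (dCov f) := by
  have h := hf.continuousOn_fderiv_of_isOpen Ω.isOpen (by simp)
  exact continuous_pi fun i => h.domRestrict.clm_apply continuous_const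

theorem IsSmoothField.smul {k : ℕ} {φ : FunRing Ω} (hφ : IsSmooth φ) {Q : MVField Ω k}
    (hQ : IsSmoothField Q) : IsSmoothField (φ • Q) :=
  fun ξ => hφ.mul (hQ ξ)

theorem IsTangential.smul {Λ : MVField Ω 2} {k : ℕ} (φ : FunRing Ω) {Q : MVField Ω k}
    (hQ : IsTangential Λ Q) : IsTangential Λ (φ • Q) :=
  fun x ξ h => by rw [MVField.smul_apply, hQ x ξ h, mul_zero]

/-! ### Moving covectors -/

theorem apply_vecCons_eq_sum {k : ℕ} (L : MultiVec n (k + 1)) (v : Fin n → ℝ)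
    (w : Fin k → Fin n → ℝ) :
    L (Matrix.vecCons v w) = ∑ i, v i * L (Matrix.vecCons (Pi.single i 1) w) := by
  let ℓ : (Fin n → ℝ) →ₗ[ℝ] ℝ :=
    { toFun := fun u => L (Matrix.vecCons u w)
      map_add' := L.map_vecCons_add w
      map_smul' := L.map_vecCons_smul w }
  change ℓ v = ∑ i, v i * ℓ (Pi.single i 1)
  nth_rw 1 [pi_eq_sum_univ' v]
  simp only [map_sum, map_smul, smul_eq_mul]

theorem IsSmoothField.vecCons {k : ℕ} {Q : MVField Ω (k + 1)} (hQ : IsSmoothField Q)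
    {c : Ω → Fin n → ℝ} (hc : ∀ i, IsSmooth (fun y => c y i)) (w : Fin k → Fin n → ℝ) :
    IsSmooth (fun y => Q y (Matrix.vecCons (c y) w)) := by
  simp only [apply_vecCons_eq_sum (Q _) (c _) w]
  exact IsSmooth.sum _ fun i _ => (hc i).mul (hQ _)

theorem dCov_apply_vecCons {k : ℕ} {Q : MVField Ω (k + 1)} (hQ : IsSmoothField Q)
    {c : Ω → Fin n → ℝ} (hc : ∀ i, IsSmooth (fun y => c y i)) (w : Fin k → Fin n → ℝ) (x : Ω) :
    dCov (fun y => Q y (Matrix.vecCons (c y) w)) x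
      = dCov (fun y => Q y (Matrix.vecCons (c x) w)) x
        + ∑ i, Q x (Matrix.vecCons (Pi.single i 1) w) • dCov (fun y => c y i) x := by
  have hQw i : IsSmooth (fun y => Q y (Matrix.vecCons (Pi.single i 1) w)) := hQ _
  simp only [apply_vecCons_eq_sum (Q _) (c _) w]
  rw [dCov_sum _ fun i _ => (hc i).mul (hQw i),
    dCov_sum _ fun i _ => (IsSmooth.const (c x i)).mul (hQw i), ← Finset.sum_add_distrib]
  refine Finset.sum_congr rfl fun i _ => ?_
  rw [diff_mul (hc i) (hQw i), diff_mul (IsSmooth.const (c x i)) (hQw i), diff_const, smul_zero,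
    add_zero]

/-! ### The coboundary operator in low degrees -/

variable (Λ : MVField Ω 2)

theorem sigma_zero_apply (Q : MVField Ω 0) (x : Ω) (ξ : Fin 1 → Fin n → ℝ) :
    sigma Λ Q x ξ = Λ x ![ξ 0, dCov (fun y => Q y ![]) x] := by
  have h : Fin.tail ξ = ![] := Subsingleton.elim _ _
  simp [sigma, bracketTerm, sharpDeriv, h]

theorem sigma_one_apply (Q : MVField Ω 1) (x : Ω) (ξ : Fin 2 → Fin n → ℝ) :
    sigma Λ Q x ξ = Λ x ![ξ 0, dCov (fun y => Q y ![ξ 1]) x]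
      - Λ x ![ξ 1, dCov (fun y => Q y ![ξ 0]) x] - Q x ![formBracket Λ (ξ 0) (ξ 1) x] := by
  have h0 : Fin.removeNth (0 : Fin 2) ξ = ![ξ 1] := by
    funext i; fin_cases i; rfl
  have h1 : Fin.removeNth (1 : Fin 2) ξ = ![ξ 0] := by
    funext i; fin_cases i; rfl
  have h2 (v : Fin n → ℝ) (w : Fin 0 → Fin n → ℝ) : (Fin.cons v w : Fin 1 → _) = ![v] := by
    funext i; fin_cases i; rfl
  simp [sigma, bracketTerm, sharpDeriv, Fin.sum_univ_succ, h0, h1, h2, ← sub_eq_add_neg]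

theorem sigma_two_apply (Q : MVField Ω 2) (x : Ω) (ξ : Fin 3 → Fin n → ℝ) :
    sigma Λ Q x ξ = Λ x ![ξ 0, dCov (fun y => Q y ![ξ 1, ξ 2]) x]
      - Λ x ![ξ 1, dCov (fun y => Q y ![ξ 0, ξ 2]) x]
      + Λ x ![ξ 2, dCov (fun y => Q y ![ξ 0, ξ 1]) x]
      - Q x ![formBracket Λ (ξ 0) (ξ 1) x, ξ 2] + Q x ![formBracket Λ (ξ 0) (ξ 2) x, ξ 1]
      - Q x ![formBracket Λ (ξ 1) (ξ 2) x, ξ 0] := by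
  have h0 : Fin.removeNth (0 : Fin 3) ξ = ![ξ 1, ξ 2] := by
    funext i; fin_cases i <;> rfl
  have h1 : Fin.removeNth (1 : Fin 3) ξ = ![ξ 0, ξ 2] := by
    funext i; fin_cases i <;> rfl
  have h2 : Fin.removeNth (2 : Fin 3) ξ = ![ξ 0, ξ 1] := by
    funext i; fin_cases i <;> rfl
  have hc0 (u v w : Fin n → ℝ) :
      (Fin.cons u (Fin.removeNth (0 : Fin 2) ![v, w]) : Fin 2 → _) = ![u, w] := by
    funext i; fin_cases i <;> rfl
  have hc1 (u v w : Fin n → ℝ) :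
      (Fin.cons u (Fin.removeNth (1 : Fin 2) ![v, w]) : Fin 2 → _) = ![u, v] := by
    funext i; fin_cases i <;> rfl
  change (∑ i : Fin 3, _) + (∑ i : Fin 3, ∑ m : Fin 2, _) = _
  simp only [sharpDeriv, Fin.sum_univ_three, Fin.sum_univ_two, h0, h1, h2, hc0, hc1]
  norm_num
  ring

theorem sigma_three_apply (Q : MVField Ω 3) (x : Ω) (ξ : Fin 4 → Fin n → ℝ) :
    sigma Λ Q x ξ = Λ x ![ξ 0, dCov (fun y => Q y ![ξ 1, ξ 2, ξ 3]) x]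
      - Λ x ![ξ 1, dCov (fun y => Q y ![ξ 0, ξ 2, ξ 3]) x]
      + Λ x ![ξ 2, dCov (fun y => Q y ![ξ 0, ξ 1, ξ 3]) x]
      - Λ x ![ξ 3, dCov (fun y => Q y ![ξ 0, ξ 1, ξ 2]) x]
      - Q x ![formBracket Λ (ξ 0) (ξ 1) x, ξ 2, ξ 3] + Q x ![formBracket Λ (ξ 0) (ξ 2) x, ξ 1, ξ 3]
      - Q x ![formBracket Λ (ξ 0) (ξ 3) x, ξ 1, ξ 2] - Q x ![formBracket Λ (ξ 1) (ξ 2) x, ξ 0, ξ 3]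
      + Q x ![formBracket Λ (ξ 1) (ξ 3) x, ξ 0, ξ 2]
      - Q x ![formBracket Λ (ξ 2) (ξ 3) x, ξ 0, ξ 1] := by
  have h0 : Fin.removeNth (0 : Fin 4) ξ = ![ξ 1, ξ 2, ξ 3] := by
    funext i; fin_cases i <;> rfl
  have h1 : Fin.removeNth (1 : Fin 4) ξ = ![ξ 0, ξ 2, ξ 3] := by
    funext i; fin_cases i <;> rfl
  have h2 : Fin.removeNth (2 : Fin 4) ξ = ![ξ 0, ξ 1, ξ 3] := by
    funext i; fin_cases i <;> rfl
  have h3 : Fin.removeNth (3 : Fin 4) ξ = ![ξ 0, ξ 1, ξ 2] := by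
    funext i; fin_cases i <;> rfl
  have hc0 (t u v w : Fin n → ℝ) :
      (Fin.cons t (Fin.removeNth (0 : Fin 3) ![u, v, w]) : Fin 3 → _) = ![t, v, w] := by
    funext i; fin_cases i <;> rfl
  have hc1 (t u v w : Fin n → ℝ) :
      (Fin.cons t (Fin.removeNth (1 : Fin 3) ![u, v, w]) : Fin 3 → _) = ![t, u, w] := by
    funext i; fin_cases i <;> rfl
  have hc2 (t u v w : Fin n → ℝ) :
      (Fin.cons t (Fin.removeNth (2 : Fin 3) ![u, v, w]) : Fin 3 → _) = ![t, u, v] := by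
    funext i; fin_cases i <;> rfl
  change (∑ i : Fin 4, _) + (∑ i : Fin 4, ∑ m : Fin 3, _) = _
  simp only [sharpDeriv, Fin.sum_univ_four, Fin.sum_univ_three, h0, h1, h2, h3, hc0, hc1, hc2,
    show Fin.succ (2 : Fin 3) = 3 from rfl]
  norm_num
  ring

theorem ham_apply (f : Ω → ℝ) (x : Ω) (ξ : Fin 1 → Fin n → ℝ) :
    ham Λ f x ξ = Λ x ![dCov f x, ξ 0] :=
  congrArg (Λ x) (by funext i; fin_cases i <;> rfl)

theorem isTangential_ham (f : Ω → ℝ) : IsTangential Λ (ham Λ f) := by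
  rintro x ξ ⟨i, hi⟩
  rw [ham_apply, ← Subsingleton.elim i 0, hi]

theorem isTangential_self : IsTangential Λ Λ := by
  rintro x ξ ⟨i, hi⟩
  rw [show ξ = ![ξ 0, ξ 1] by funext i; fin_cases i <;> rfl]
  fin_cases i
  · rw [lambda_skew, show Λ x ![ξ 1, ξ 0] = 0 from hi _, neg_zero]
  · exact hi _

end General

theorem sum_smul_mem_of_sum_mkQ_eq_zero {R M ι : Type*} [CommRing R] [AddCommGroup M] [Module R M]
    {N Z : Submodule R M} {s : Finset ι} {g : ι → R} {Q : ι → M} {hQ : ∀ i, Q i ∈ Z}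
    (h : ∑ i ∈ s, g i • (N.submoduleOf Z).mkQ ⟨Q i, hQ i⟩ = 0) : ∑ i ∈ s, g i • Q i ∈ N := by
  simp only [← map_smul, ← map_sum] at h
  have hmem : Z.subtype (∑ i ∈ s, g i • ⟨Q i, hQ i⟩) ∈ N :=
    (Submodule.Quotient.mk_eq_zero (N.submoduleOf Z)).mp h
  rwa [map_sum] at hmem

theorem alternatingMap_eq_zero_of_apply_eq_zero {K V W ι : Type*} [Field K] [AddCommGroup V]
    [Module K V] [Module.Finite K V] [AddCommGroup W] [Module K W] [Finite ι]
    (hι : Module.finrank K V ≤ Nat.card ι) {v : V} (hv : v ≠ 0) {L : V [⋀^ι]→ₗ[K] W}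
    (hL : ∀ w : ι → V, (∃ i, w i = v) → L w = 0) : L = 0 := by
  have hli : LinearIndepOn K id ({v} : Set V) := LinearIndepOn.singleton hv
  have hvmem : v ∈ hli.extend (Set.subset_univ _) := hli.subset_extend _ rfl
  have := Module.Finite.finite_basis (Module.Basis.extend hli)
  refine Module.Basis.ext_alternating (Module.Basis.extend hli) fun w hw => ?_
  have hbij := hw.bijective_of_nat_card_le <| by
    rwa [← Module.finrank_eq_nat_card_basis (Module.Basis.extend hli)]
  obtain ⟨i, hi⟩ := hbij.2 ⟨v, hvmem⟩
  exact hL _ ⟨i, by rw [hi, Module.Basis.extend_apply_self]⟩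

section Complex

variable {n : ℕ} {Ω : TopologicalSpace.Opens (Fin n → ℝ)} {Λ : MVField Ω 2}

/-! ### Extreme degrees -/

variable (Λ) in
/-- Casimir functions are the tangential cocycles of degree `0`. -/
def casimirCocycle : casimirs Λ →ₗ[casimirs Λ] cocycles Λ (tangentialFields Λ) 0 where
  toFun c := ⟨ofFun c.1, ⟨fun _ => c.2.1, fun _ _ h => h.elim fun i => i.elim0⟩, fun _ => c.2.1,
    fun x ξ => by
      rw [sigma_zero_apply]
      exact (sharpDeriv_casimir c.2 (ξ 0) x).symm⟩
  map_add' _ _ := rfl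
  map_smul' _ _ := rfl

theorem casimirCocycle_bijective : Function.Bijective (casimirCocycle Λ) := by
  constructor
  · intro c c' h
    refine Subtype.ext (funext fun x => ?_)
    exact congrArg (fun Q : cocycles Λ (tangentialFields Λ) 0 => Q.1 x ![]) h
  · rintro ⟨Q, -, hQ, hσ⟩
    have hc : (fun x => Q x ![] : FunRing Ω) ∈ casimirs Λ := by
      refine ⟨hQ ![], fun x => AlternatingMap.ext fun ξ => ?_⟩
      have h := hσ x ![ξ 0]
      rw [sigma_zero_apply] at h
      rw [ham_apply, lambda_skew]
      exact neg_eq_zero.mpr h.symm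
    refine ⟨⟨_, hc⟩, Subtype.ext (funext fun x => AlternatingMap.ext fun ξ => ?_)⟩
    rw [Subsingleton.elim ξ ![]]
    rfl

variable (Λ) in
theorem nonempty_HTan_zero_equiv : Nonempty (HTan Λ 0 ≃ₗ[casimirs Λ] casimirs Λ) := by
  have hbot : (coboundaries Λ (tangentialFields Λ) 0).submoduleOf
      (cocycles Λ (tangentialFields Λ) 0) = ⊥ :=
    (Submodule.eq_bot_iff _).mpr fun _ hQ => Subtype.ext hQ
  exact ⟨(Submodule.quotEquivOfEqBot _ hbot).trans
    (LinearEquiv.ofBijective _ casimirCocycle_bijective).symm⟩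

theorem IsTangential.eq_zero (hΛ : ∀ x, ∃ v ≠ 0, ∀ η, Λ x ![η, v] = 0) {k : ℕ} (hk : n ≤ k)
    {Q : MVField Ω k} (hQ : IsTangential Λ Q) : Q = 0 := by
  funext x
  obtain ⟨v, hv, hann⟩ := hΛ x
  refine alternatingMap_eq_zero_of_apply_eq_zero (by simpa using hk) hv fun w ⟨i, hi⟩ => ?_
  exact hQ x w ⟨i, by rwa [hi]⟩

theorem subsingleton_HTan (hΛ : ∀ x, ∃ v ≠ 0, ∀ η, Λ x ![η, v] = 0) {k : ℕ} (hk : n ≤ k) :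
    Subsingleton (HTan Λ k) := by
  have : Subsingleton (cocycles Λ (tangentialFields Λ) k) :=
    ⟨fun Q Q' => Subtype.ext ((Q.2.1.2.eq_zero hΛ hk).trans (Q'.2.1.2.eq_zero hΛ hk).symm)⟩
  exact (Submodule.mkQ_surjective _).subsingleton

/-! ### Linear relations between cohomology classes -/

variable {C : (k : ℕ) → Submodule (casimirs Λ) (MVField Ω k)} {k : ℕ}

variable (Λ C k) in
/-- The class of a cocycle in the cohomology of a complex `(C, σ)`; for tangential fields this is
`tanClass`. -/
def cohomologyClass (Q : cocycles Λ C k) : Cohomology Λ C k :=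
  ((coboundaries Λ C k).submoduleOf (cocycles Λ C k)).mkQ Q

theorem sum_smul_mem_coboundaries {ι : Type*} {s : Finset ι} {g : ι → casimirs Λ}
    {Q : ι → MVField Ω k} {hQ : ∀ i, Q i ∈ cocycles Λ C k}
    (h : ∑ i ∈ s, g i • cohomologyClass Λ C k ⟨Q i, hQ i⟩ = 0) :
    ∑ i ∈ s, g i • Q i ∈ coboundaries Λ C k :=
  sum_smul_mem_of_sum_mkQ_eq_zero h

end Complex

/-! ### The Poisson structure of `sl(2)` -/

theorem slΛ_apply (x : slΩ) (ξ η : Fin 3 → ℝ) :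
    slΛ x ![ξ, η] = x.1 0 * (ξ 1 * η 2 - ξ 2 * η 1) + x.1 1 * (ξ 2 * η 0 - ξ 0 * η 2)
      - x.1 2 * (ξ 0 * η 1 - ξ 1 * η 0) := by
  change x.1 ⬝ᵥ slBracket ξ η = _
  simp only [slBracket, dotProduct, Fin.sum_univ_three, Matrix.cons_val]
  ring

theorem formBracket_slΛ (ξ η : Fin 3 → ℝ) (x : slΩ) :
    formBracket slΛ ξ η x = slBracket ξ η :=
  dCov_dotProduct (slBracket ξ η) x

theorem slΛ_jacobi (x : slΩ) (ξ η ζ : Fin 3 → ℝ) :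
    slΛ x ![ξ, slBracket η ζ] + slΛ x ![η, slBracket ζ ξ] + slΛ x ![ζ, slBracket ξ η] = 0 := by
  simp only [slΛ_apply, slBracket, Matrix.cons_val]
  ring

theorem slΛ_slBracket_swap (x : slΩ) (ξ η ζ : Fin 3 → ℝ) :
    slΛ x ![ξ, slBracket η ζ] = -slΛ x ![ξ, slBracket ζ η] := by
  simp only [slΛ_apply, slBracket, Matrix.cons_val]
  ring

theorem slΛ_plucker (x : slΩ) (ξ η ζ θ : Fin 3 → ℝ) :
    slΛ x ![ξ, η] * slΛ x ![ζ, θ] - slΛ x ![ξ, ζ] * slΛ x ![η, θ]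
      + slΛ x ![ξ, θ] * slΛ x ![η, ζ] = 0 := by
  simp only [slΛ_apply]
  ring

theorem isSmoothField_slΛ : IsSmoothField slΛ :=
  fun ξ => isSmooth_dotProduct (slBracket (ξ 0) (ξ 1))

theorem normSq3_pos {x : Fin 3 → ℝ} (hx : x ∈ slΩ) : 0 < normSq3 x := by
  have hdot : normSq3 x = x ⬝ᵥ x := by
    simp only [normSq3, dotProduct, Fin.sum_univ_three]
    ring
  rw [hdot, ← star_trivial x, ← star_trivial x]
  exact Matrix.dotProduct_star_self_pos_iff.mpr hx

/-- Half the differential of the Casimir function `x₁² + x₂² - x₃²`; it spans the annihilator of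
the symplectic leaf through `x`. -/
def casimirCovector (x : slΩ) : Fin 3 → ℝ := ![x.1 0, x.1 1, -x.1 2]

theorem slΛ_casimirCovector (x : slΩ) (η : Fin 3 → ℝ) : slΛ x ![η, casimirCovector x] = 0 := by
  simp only [slΛ_apply, casimirCovector, Matrix.cons_val]
  ring

theorem casimirCovector_ne_zero (x : slΩ) : casimirCovector x ≠ 0 := by
  intro h
  refine x.2 ?_
  funext i
  have hi := congrFun h i
  fin_cases i <;> simpa [casimirCovector] using hi

theorem dCov_casimirCovector (i : Fin 3) (x : slΩ) :
    dCov (fun y => casimirCovector y i) x = (![1, 1, -1] : Fin 3 → ℝ) i • Pi.single i 1 := by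
  fin_cases i
  · exact (dCov_coord 0 x).trans (one_smul ..).symm
  · exact (dCov_coord 1 x).trans (one_smul ..).symm
  · exact (dCov_neg (isSmooth_coord 2) x).trans (by rw [dCov_coord]; exact (neg_one_smul ..).symm)

theorem isSmooth_casimirCovector (i : Fin 3) : IsSmooth (fun y => casimirCovector y i) := by
  fin_cases i
  exacts [isSmooth_coord 0, isSmooth_coord 1, (isSmooth_coord 2).neg]

theorem slBracket_casimirCovector (x : slΩ) (ξ : Fin 3 → ℝ) :
    slBracket (casimirCovector x) ξ
      = fun i => (![1, 1, -1] : Fin 3 → ℝ) i * slΛ x ![ξ, Pi.single i 1] := by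
  funext i
  fin_cases i <;> simp [slBracket, casimirCovector, slΛ_apply] <;> ring

/-! ### Cocycles on `sl(2)^* \ {0}` -/

theorem dCov_mul_slΛ {φ : slΩ → ℝ} (hφ : IsSmooth φ) (ξ η : Fin 3 → ℝ) (x : slΩ) :
    dCov (fun y => φ y * slΛ y ![ξ, η]) x = φ x • slBracket ξ η + slΛ x ![ξ, η] • dCov φ x := by
  rw [diff_mul hφ (isSmoothField_slΛ _)]
  rw [← formBracket_slΛ ξ η x, formBracket]

theorem isSigma_smul_slΛ {φ : FunRing slΩ} (hφ : IsSmooth φ) : IsSigma slΛ (φ • slΛ) 0 := by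
  intro x ξ
  rw [sigma_two_apply]
  simp only [dCov_mul_slΛ hφ, formBracket_slΛ, lambda_add, lambda_smul, MVField.smul_apply,
    lambda_skew x (slBracket _ _)]
  change (0 : ℝ) = _
  linear_combination -2 * φ x * slΛ_jacobi x (ξ 0) (ξ 1) (ξ 2)
    + 2 * φ x * slΛ_slBracket_swap x (ξ 1) (ξ 0) (ξ 2)
    - slΛ_plucker x (ξ 0) (ξ 1) (ξ 2) (dCov φ x)

/-- The Hamiltonian vector field of the coordinate `x₃`. -/
def hamX3 : MVField slΩ 1 := ham slΛ (fun y => y.1 2)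

theorem hamX3_apply (x : slΩ) (ξ : Fin 1 → Fin 3 → ℝ) :
    hamX3 x ξ = slΛ x ![Pi.single 2 1, ξ 0] := by
  rw [hamX3, ham_apply, dCov_coord]

theorem isSmoothField_hamX3 : IsSmoothField hamX3 := by
  intro ξ
  simp only [hamX3_apply]
  exact isSmoothField_slΛ _

theorem isSigma_smul_hamX3 {a : FunRing slΩ} (ha : IsSmooth a)
    (h : ∀ x, slΛ x ![Pi.single 2 1, dCov a x] = 0) : IsSigma slΛ (a • hamX3) 0 := by
  intro x ξ
  rw [sigma_one_apply]
  simp only [MVField.smul_apply, hamX3_apply, Matrix.cons_val_fin_one, dCov_mul_slΛ ha,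
    formBracket_slΛ, lambda_add, lambda_smul]
  change (0 : ℝ) = _
  linear_combination a x * slΛ_slBracket_swap x (Pi.single 2 1) (ξ 1) (ξ 0)
    + a x * slΛ_slBracket_swap x (ξ 1) (ξ 0) (Pi.single 2 1)
    - a x * slΛ_jacobi x (ξ 0) (Pi.single 2 1) (ξ 1)
    + slΛ_plucker x (Pi.single 2 1) (ξ 0) (ξ 1) (dCov a x)
    - slΛ x ![ξ 0, ξ 1] * h x

/-- The trivector field `∂₁ ∧ ∂₂ ∧ ∂₃`. -/
def volField : MVField slΩ 3 := fun _ => Matrix.detRowAlternating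

theorem volField_apply (x : slΩ) (ξ : Fin 3 → Fin 3 → ℝ) :
    volField x ξ = ξ 0 0 * (ξ 1 1 * ξ 2 2 - ξ 1 2 * ξ 2 1)
      - ξ 0 1 * (ξ 1 0 * ξ 2 2 - ξ 1 2 * ξ 2 0) + ξ 0 2 * (ξ 1 0 * ξ 2 1 - ξ 1 1 * ξ 2 0) := by
  change Matrix.det (Matrix.of ξ) = _
  rw [Matrix.det_fin_three]
  simp only [Matrix.of_apply]
  ring

theorem slΛ_eq_volField (x : slΩ) (ξ η : Fin 3 → ℝ) :
    slΛ x ![ξ, η] = volField x ![casimirCovector x, ξ, η] := by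
  simp only [slΛ_apply, volField_apply, casimirCovector, Matrix.cons_val]
  ring

theorem isSmoothField_volField : IsSmoothField volField :=
  fun ξ => IsSmooth.const (Matrix.det ξ)

theorem isSigma_smul_volField {φ : FunRing slΩ} (hφ : IsSmooth φ) :
    IsSigma slΛ (φ • volField) 0 := by
  intro x ξ
  rw [sigma_three_apply]
  simp only [MVField.smul_apply, volField_apply, dCov_mul_const hφ, formBracket_slΛ, lambda_smul]
  simp only [slΛ_apply, slBracket, Matrix.cons_val]
  change (0 : ℝ) = _
  ring

/-! ### Radial functions -/

/-- The function `ψ (x₁² + x₂² + x₃²)`. -/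
def radial (ψ : ℝ → ℝ) : FunRing slΩ := fun x => ψ (normSq3 x.1)

theorem isSmooth_normSq3 : IsSmooth (fun x : slΩ => normSq3 x.1) := by
  simp only [normSq3, sq]
  exact (((isSmooth_coord 0).mul (isSmooth_coord 0)).add
    ((isSmooth_coord 1).mul (isSmooth_coord 1))).add ((isSmooth_coord 2).mul (isSmooth_coord 2))

theorem dCov_normSq3 (x : slΩ) : dCov (fun y : slΩ => normSq3 y.1) x = (2 : ℝ) • x.1 := by
  have hsq (i : Fin 3) : IsSmooth (fun y : slΩ => y.1 i * y.1 i) :=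
    (isSmooth_coord i).mul (isSmooth_coord i)
  have hd (i : Fin 3) :
      dCov (fun y : slΩ => y.1 i * y.1 i) x = (2 * x.1 i) • Pi.single i 1 := by
    rw [diff_mul (isSmooth_coord i) (isSmooth_coord i), dCov_coord, ← add_smul, two_mul]
  simp only [normSq3, sq]
  rw [diff_add ((hsq 0).add (hsq 1)) (hsq 2), diff_add (hsq 0) (hsq 1), hd, hd, hd]
  funext i
  fin_cases i <;> simp

theorem isSmooth_radial {ψ : ℝ → ℝ} (hψ : ContDiffOn ℝ ∞ ψ (Set.Ioi 0)) : IsSmooth (radial ψ) :=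
  IsSmooth.comp hψ isSmooth_normSq3 fun x => normSq3_pos x.2

theorem slΛ_single_two_dCov_radial {ψ : ℝ → ℝ} (hψ : ContDiffOn ℝ ∞ ψ (Set.Ioi 0)) (x : slΩ) :
    slΛ x ![Pi.single 2 1, dCov (radial ψ) x] = 0 := by
  have hdiff : DifferentiableAt ℝ ψ (normSq3 x.1) :=
    (hψ.contDiffAt (Ioi_mem_nhds (normSq3_pos x.2))).differentiableAt (by simp)
  have hrot : slΛ x ![Pi.single 2 1, x.1] = 0 := by
    simp only [slΛ_apply, ne_eq, Fin.reduceEq, not_false_eq_true, Pi.single_eq_of_ne,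
      Pi.single_eq_same]
    ring
  unfold radial
  rw [dCov_comp isSmooth_normSq3 hdiff, dCov_normSq3, lambda_smul, lambda_smul, hrot, mul_zero,
    mul_zero]

/-- The radial profile `y ↦ y ^ (-α)` of `t̂_α`. -/
def powProfile (α y : ℝ) : ℝ := 1 / y ^ α

/-- The radial profile `y ↦ exp (α / y) / y²` of `k̂_α`. -/
def expProfile (α y : ℝ) : ℝ := Real.exp (α / y) / y ^ 2

theorem contDiffOn_powProfile (α : ℝ) : ContDiffOn ℝ ∞ (powProfile α) (Set.Ioi 0) :=
  fun _ hy => (contDiffAt_const.div (Real.contDiffAt_rpow_const_of_ne (ne_of_gt hy))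
    (Real.rpow_pos_of_pos hy α).ne').contDiffWithinAt

theorem contDiffOn_expProfile (α : ℝ) : ContDiffOn ℝ ∞ (expProfile α) (Set.Ioi 0) :=
  fun _ hy => ((contDiffAt_const.div contDiffAt_id (ne_of_gt hy)).exp.div (contDiffAt_id.pow 2)
    (pow_ne_zero 2 (ne_of_gt hy))).contDiffWithinAt

section Cocycles

variable {ψ : ℝ → ℝ} (hψ : ContDiffOn ℝ ∞ ψ (Set.Ioi 0))
include hψ

theorem radial_smul_hamX3_mem_cocycles :
    radial ψ • hamX3 ∈ cocycles slΛ (tangentialFields slΛ) 1 :=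
  have hsmooth := isSmoothField_hamX3.smul (isSmooth_radial hψ)
  ⟨⟨hsmooth, (isTangential_ham slΛ _).smul _⟩,
    hsmooth, isSigma_smul_hamX3 (isSmooth_radial hψ) (slΛ_single_two_dCov_radial hψ)⟩

theorem radial_smul_slΛ_mem_cocycles :
    radial ψ • slΛ ∈ cocycles slΛ (tangentialFields slΛ) 2 :=
  have hsmooth := isSmoothField_slΛ.smul (isSmooth_radial hψ)
  ⟨⟨hsmooth, (isTangential_self slΛ).smul _⟩, hsmooth, isSigma_smul_slΛ (isSmooth_radial hψ)⟩

theorem radial_smul_volField_mem_cocycles : radial ψ • volField ∈ cocycles slΛ (fields slΛ) 3 :=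
  have hsmooth := isSmoothField_volField.smul (isSmooth_radial hψ)
  ⟨hsmooth, hsmooth, isSigma_smul_volField (isSmooth_radial hψ)⟩

end Cocycles

theorem cocycles_tangentialFields_le {n : ℕ} {Ω : TopologicalSpace.Opens (Fin n → ℝ)}
    (Λ : MVField Ω 2) (k : ℕ) : cocycles Λ (tangentialFields Λ) k ≤ cocycles Λ (fields Λ) k :=
  inf_le_inf_right _ fun _ hQ => hQ.1

/-! ### Parametrization of the leaves -/

theorem normSq3_param (p q z : ℝ) : normSq3 (param p q z) = 2 * p ^ 2 + z ^ 2 := by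
  simp only [normSq3, param, Matrix.cons_val]
  linear_combination (p ^ 2 + z ^ 2) * Real.sin_sq_add_cos_sq q

theorem param_mem {p q z : ℝ} (h : p ≠ 0 ∨ z ≠ 0) : param p q z ∈ slΩ := by
  intro h0
  have hpos : 0 < 2 * p ^ 2 + z ^ 2 := by
    rcases h with h | h <;> positivity
  rw [← normSq3_param p q z, Set.mem_singleton_iff.mp h0] at hpos
  simp [normSq3] at hpos

theorem param_two_pi (p z : ℝ) : param p (2 * Real.pi) z = param p 0 z := by
  simp only [param, Real.sin_two_pi, Real.cos_two_pi, Real.sin_zero, Real.cos_zero]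

theorem continuous_param : Continuous fun t : ℝ × ℝ × ℝ => param t.1 t.2.1 t.2.2 := by
  refine continuous_pi fun i => ?_
  fin_cases i <;> simp only [param] <;> fun_prop

/-- The velocity of the curve `p ↦ param p q z`. -/
def velP (q : ℝ) : Fin 3 → ℝ := ![-Real.sin q, -Real.cos q, 1]

/-- The velocity of the curve `q ↦ param p q z` at the point `x`; this is `H_{x₃}`. -/
def velQ (x : Fin 3 → ℝ) : Fin 3 → ℝ := ![x 1, -x 0, 0]

theorem continuous_velP : Continuous velP := by
  refine continuous_pi fun i => ?_
  fin_cases i <;> simp only [velP] <;> fun_prop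

theorem hasDerivAt_param_p (p q z : ℝ) : HasDerivAt (fun p => param p q z) (velP q) p := by
  rw [hasDerivAt_pi]
  have hid := hasDerivAt_id' p
  intro i
  fin_cases i
  · exact ((hid.neg.mul_const (Real.sin q)).add_const _).congr_deriv (neg_one_mul _)
  · exact ((hid.neg.mul_const (Real.cos q)).sub_const _).congr_deriv (neg_one_mul _)
  · exact hid

theorem hasDerivAt_param_q (p q z : ℝ) :
    HasDerivAt (fun q => param p q z) (velQ (param p q z)) q := by
  rw [hasDerivAt_pi]
  have hsin := Real.hasDerivAt_sin q
  have hcos := Real.hasDerivAt_cos q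
  intro i
  fin_cases i
  · exact ((hsin.const_mul (-p)).add (hcos.const_mul z)).congr_deriv (by simp [param, velQ]; ring)
  · exact ((hcos.const_mul (-p)).sub (hsin.const_mul z)).congr_deriv (by simp [param, velQ]; ring)
  · exact hasDerivAt_const q p

theorem hasDerivAt_zeroExt_param_p {f : slΩ → ℝ} (hf : IsSmooth f) {p q z : ℝ}
    (h : param p q z ∈ slΩ) :
    HasDerivAt (fun p => zeroExt f (param p q z)) (dCov f ⟨param p q z, h⟩ ⬝ᵥ velP q) p :=
  hasDerivAt_zeroExt_comp (γ := fun p => param p q z) hf h (hasDerivAt_param_p p q z)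

theorem hasDerivAt_zeroExt_param_q {f : slΩ → ℝ} (hf : IsSmooth f) {p q z : ℝ}
    (h : param p q z ∈ slΩ) :
    HasDerivAt (fun q => zeroExt f (param p q z))
      (dCov f ⟨param p q z, h⟩ ⬝ᵥ velQ (param p q z)) q :=
  hasDerivAt_zeroExt_comp (γ := fun q => param p q z) hf h (hasDerivAt_param_q p q z)

theorem continuous_zeroExt_param {X : Type*} [TopologicalSpace X] {f : slΩ → ℝ} (hf : IsSmooth f)
    {p q z : X → ℝ} (hp : Continuous p) (hq : Continuous q) (hz : Continuous z)
    (h : ∀ t, p t ≠ 0 ∨ z t ≠ 0) : Continuous fun t => zeroExt f (param (p t) (q t) (z t)) :=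
  hf.continuousOn.comp_continuous (continuous_param.comp (hp.prodMk (hq.prodMk hz)))
    fun t => param_mem (h t)

theorem continuous_dCov_param_velP {f : slΩ → ℝ} (hf : IsSmooth f) {z : ℝ}
    (h : ∀ p q, param p q z ∈ slΩ) :
    Continuous fun t : ℝ × ℝ => dCov f ⟨param t.1 t.2 z, h t.1 t.2⟩ ⬝ᵥ velP t.2 := by
  have hparam : Continuous fun t : ℝ × ℝ => (⟨param t.1 t.2 z, h t.1 t.2⟩ : slΩ) :=
    (continuous_param.comp (continuous_fst.prodMk (continuous_snd.prodMk
      continuous_const))).subtype_mk _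
  exact (hf.continuous_dCov.comp hparam).dotProduct (continuous_velP.comp continuous_snd)

theorem slΛ_single_two (x : slΩ) (ξ : Fin 3 → ℝ) : slΛ x ![Pi.single 2 1, ξ] = ξ ⬝ᵥ velQ x := by
  simp only [slΛ_apply, velQ, dotProduct, Fin.sum_univ_three, Matrix.cons_val, ne_eq, Fin.reduceEq,
    not_false_eq_true, Pi.single_eq_of_ne, Pi.single_eq_same]
  ring

/-- A covector at `x` which, at `x = param p q z`, `Λ` sends to `-(p² + z²)` times the velocity
`velP q`; together with `x₃` it spans the covectors of the leaf. -/
def angleCovector (z : ℝ) (x : Fin 3 → ℝ) : Fin 3 → ℝ := ![x 1, -x 0, -z]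

theorem slΛ_angleCovector {p q z : ℝ} (h : param p q z ∈ slΩ) (ξ : Fin 3 → ℝ) :
    slΛ ⟨param p q z, h⟩ ![angleCovector z (param p q z), ξ]
      = -(p ^ 2 + z ^ 2) * (ξ ⬝ᵥ velP q) := by
  simp only [slΛ_apply, angleCovector, param, velP, dotProduct, Fin.sum_univ_three,
    Matrix.cons_val]
  linear_combination -ξ 2 * (p ^ 2 + z ^ 2) * Real.sin_sq_add_cos_sq q

theorem angleCovector_dotProduct_velQ (p q z : ℝ) :
    angleCovector z (param p q z) ⬝ᵥ velQ (param p q z) = p ^ 2 + z ^ 2 := by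
  simp only [angleCovector, velQ, param, dotProduct, Fin.sum_univ_three, Matrix.cons_val]
  linear_combination (p ^ 2 + z ^ 2) * Real.sin_sq_add_cos_sq q

theorem casimir_param {c : FunRing slΩ} (hc : c ∈ casimirs slΛ) {z : ℝ} (hz : 0 < z)
    (p q p' q' : ℝ) : zeroExt c (param p q z) = zeroExt c (param p' q' z) := by
  have hmem (p q) : param p q z ∈ slΩ := param_mem (Or.inr hz.ne')
  have hΛ (x : slΩ) (η) : slΛ x ![η, dCov c x] = 0 := sharpDeriv_casimir hc η x
  have hp p q : HasDerivAt (fun p => zeroExt c (param p q z)) 0 p := by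
    have h := hΛ ⟨param p q z, hmem p q⟩ (angleCovector z (param p q z))
    rw [slΛ_angleCovector] at h
    exact (hasDerivAt_zeroExt_param_p hc.1 (hmem p q)).congr_deriv
      ((mul_eq_zero.mp h).resolve_left (by nlinarith))
  have hq p q : HasDerivAt (fun q => zeroExt c (param p q z)) 0 q := by
    have h := hΛ ⟨param p q z, hmem p q⟩ (Pi.single 2 1)
    rw [slΛ_single_two] at h
    exact (hasDerivAt_zeroExt_param_q hc.1 (hmem p q)).congr_deriv h
  rw [is_const_of_deriv_eq_zero (fun p => (hp p q).differentiableAt) (fun p => (hp p q).deriv) p p']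
  exact is_const_of_deriv_eq_zero (fun q => (hq p' q).differentiableAt)
    (fun q => (hq p' q).deriv) q q'

/-! ### Limit obstructions -/

theorem exists_tendsto_integral_of_isSigma_smul_hamX3 {a : FunRing slΩ} (ha : IsSmooth a)
    {Q : MVField slΩ 0} (hQ : IsSmoothField Q) (h : IsSigma slΛ Q (a • hamX3)) (q : ℝ) :
    ∃ L : ℝ, Filter.Tendsto (fun z => ∫ s in (-1 : ℝ)..1, zeroExt a (param s q z))
      (𝓝[>] 0) (𝓝 L) := by
  let f : slΩ → ℝ := fun x => Q x ![]
  have hf : IsSmooth f := hQ _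
  have hderiv {z : ℝ} (hz : 0 < z) (p : ℝ) :
      HasDerivAt (fun p => -zeroExt f (param p q z)) (zeroExt a (param p q z)) p := by
    have hmem : param p q z ∈ slΩ := param_mem (Or.inr hz.ne')
    have hσ := h ⟨param p q z, hmem⟩ ![angleCovector z (param p q z)]
    rw [sigma_zero_apply, MVField.smul_apply, hamX3_apply, slΛ_single_two, Matrix.cons_val_zero,
      slΛ_angleCovector, angleCovector_dotProduct_velQ] at hσ
    refine (hasDerivAt_zeroExt_param_p hf hmem).neg.congr_deriv ?_
    rw [zeroExt_of_mem a hmem]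
    refine mul_left_cancel₀ (by positivity : p ^ 2 + z ^ 2 ≠ 0) ?_
    linear_combination -hσ
  have hintegral {z : ℝ} (hz : 0 < z) : ∫ s in (-1 : ℝ)..1, zeroExt a (param s q z)
      = zeroExt f (param (-1) q z) - zeroExt f (param 1 q z) := by
    rw [intervalIntegral.integral_eq_sub_of_hasDerivAt (fun p _ => hderiv hz p)
      ((continuous_zeroExt_param ha continuous_id continuous_const continuous_const
        fun _ => Or.inr hz.ne').intervalIntegrable _ _)]
    ring
  have hcont {p : ℝ} (hp : p ≠ 0) : Continuous fun z => zeroExt f (param p q z) :=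
    continuous_zeroExt_param hf continuous_const continuous_const continuous_id fun _ => Or.inl hp
  refine ⟨_, ((((hcont (neg_ne_zero.mpr one_ne_zero)).sub (hcont one_ne_zero)).tendsto
    0).mono_left nhdsWithin_le_nhds).congr' ?_⟩
  filter_upwards [self_mem_nhdsWithin] with z hz using (hintegral hz).symm

/-- Stokes' theorem on a cylinder with coordinates `(p, q)`, for the closed form
`d(u dq - w dp) = φ dp ∧ dq`. -/
theorem integral_mul_eq_integral_sub_of_hasDerivAt_periodic {φ : ℝ → ℝ} {u u' w : ℝ → ℝ → ℝ}
    {T : ℝ} (hu' : Continuous ↿u')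
    (hu : ∀ p q, HasDerivAt (fun p => u p q) (u' p q) p)
    (hw : ∀ p q, HasDerivAt (w p) (φ p - u' p q) q) (hperiod : ∀ p, w p T = w p 0) (a b : ℝ) :
    ∫ p in a..b, T * φ p = ∫ q in (0 : ℝ)..T, (u b q - u a q) := by
  have hu'p p : Continuous (u' p) := hu'.uncurry_left p
  have hcircle p : T * φ p = ∫ q in (0 : ℝ)..T, u' p q := by
    have h := intervalIntegral.integral_eq_sub_of_hasDerivAt (a := 0) (b := T) (fun q _ => hw p q)
      ((continuous_const.sub (hu'p p)).intervalIntegrable _ _)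
    rw [intervalIntegral.integral_sub (continuous_const.intervalIntegrable _ _)
      ((hu'p p).intervalIntegrable _ _), intervalIntegral.integral_const, hperiod, sub_self,
      sub_zero, smul_eq_mul] at h
    linarith
  have hint : MeasureTheory.IntegrableOn ↿u' (Set.uIoc a b ×ˢ Set.uIoc 0 T) :=
    (hu'.continuousOn.integrableOn_compact (isCompact_uIcc.prod isCompact_uIcc)).mono_set
      (Set.prod_mono Set.uIoc_subset_uIcc Set.uIoc_subset_uIcc)
  simp only [hcircle]
  rw [MeasureTheory.intervalIntegral_intervalIntegral_swap hint]
  exact intervalIntegral.integral_congr fun q _ =>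
    intervalIntegral.integral_eq_sub_of_hasDerivAt (fun p _ => hu p q)
      ((hu'.uncurry_right q).intervalIntegrable _ _)

/-- On the leaves, `φ` depends only on the parameters `(p, z)`, not on the angle `q`. -/
def IsAngleInvariant (φ : slΩ → ℝ) : Prop :=
  ∀ p q q' z : ℝ, 0 < z → zeroExt φ (param p q z) = zeroExt φ (param p q' z)

theorem dCov_angleCovector (z : ℝ) (i : Fin 3) (x : slΩ) :
    dCov (fun y => angleCovector z y.1 i) x
      = (![Pi.single 1 1, -Pi.single 0 1, 0] : Fin 3 → Fin 3 → ℝ) i := by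
  fin_cases i
  · exact dCov_coord 1 x
  · exact (dCov_neg (isSmooth_coord 0) x).trans (by rw [dCov_coord]; rfl)
  · exact diff_const (-z) x

theorem isSmooth_angleCovector (z : ℝ) (i : Fin 3) :
    IsSmooth (fun y : slΩ => angleCovector z y.1 i) := by
  fin_cases i
  exacts [isSmooth_coord 1, (isSmooth_coord 0).neg, IsSmooth.const (-z)]

/-- The exactness equation `φ Λ = σ B` on the leaf of parameter `z`, evaluated on `dx₃` and
`angleCovector z`. -/
theorem mul_eq_add_of_isSigma_smul_slΛ {φ : FunRing slΩ} {B : MVField slΩ 1}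
    (hB : IsSmoothField B) (h : IsSigma slΛ B (φ • slΛ)) {p q z : ℝ} (hx : param p q z ∈ slΩ) :
    φ ⟨param p q z, hx⟩ * (p ^ 2 + z ^ 2)
      = dCov (fun y => B y ![angleCovector z y.1]) ⟨param p q z, hx⟩ ⬝ᵥ velQ (param p q z)
        + (p ^ 2 + z ^ 2) * (dCov (fun y => B y ![Pi.single 2 1]) ⟨param p q z, hx⟩ ⬝ᵥ velP q) := by
  set x : slΩ := ⟨param p q z, hx⟩
  have hmoving := dCov_apply_vecCons hB (isSmooth_angleCovector z) ![] x
  have hσ := h x ![Pi.single 2 1, angleCovector z x.1]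
  rw [sigma_one_apply, formBracket_slΛ] at hσ
  simp only [MVField.smul_apply, Matrix.cons_val] at hσ
  rw [slΛ_single_two, slΛ_single_two, slΛ_angleCovector, angleCovector_dotProduct_velQ] at hσ
  have hbracket : B x ![slBracket (Pi.single 2 1) (angleCovector z x.1)]
      = -((∑ i, B x ![Pi.single i 1] • dCov (fun y => angleCovector z y.1 i) x) ⬝ᵥ velQ x.1) := by
    rw [apply_vecCons_eq_sum]
    simp only [dCov_angleCovector]
    simp only [Fin.sum_univ_three, slBracket, angleCovector, velQ, dotProduct, Matrix.cons_val,
      Pi.add_apply, Pi.smul_apply, Pi.neg_apply, Pi.zero_apply, ne_eq, Fin.reduceEq,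
      not_false_eq_true, Pi.single_eq_of_ne, Pi.single_eq_same, smul_eq_mul]
    ring
  rw [hmoving, add_dotProduct]
  linear_combination hσ - hbracket

theorem exists_tendsto_integral_of_isSigma_smul_slΛ {φ : FunRing slΩ}
    (hinv : IsAngleInvariant φ) {B : MVField slΩ 1} (hB : IsSmoothField B)
    (h : IsSigma slΛ B (φ • slΛ)) (q : ℝ) :
    ∃ L : ℝ, Filter.Tendsto (fun z => ∫ s in (-1 : ℝ)..1, 2 * Real.pi * zeroExt φ (param s q z))
      (𝓝[>] 0) (𝓝 L) := by
  let b : slΩ → ℝ := fun x => B x ![Pi.single 2 1]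
  have hb : IsSmooth b := hB _
  have hintegral {z : ℝ} (hz : 0 < z) :
      ∫ s in (-1 : ℝ)..1, 2 * Real.pi * zeroExt φ (param s q z)
        = ∫ r in (0 : ℝ)..2 * Real.pi, (zeroExt b (param 1 r z) - zeroExt b (param (-1) r z)) := by
    have hmem (p r) : param p r z ∈ slΩ := param_mem (Or.inr hz.ne')
    let g : slΩ → ℝ := fun y => B y ![angleCovector z y.1]
    have hg : IsSmooth g := hB.vecCons (isSmooth_angleCovector z) ![]
    refine integral_mul_eq_integral_sub_of_hasDerivAt_periodic
      (w := fun p r => zeroExt g (param p r z) / (p ^ 2 + z ^ 2))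
      (continuous_dCov_param_velP hb hmem)
      (fun p r => hasDerivAt_zeroExt_param_p hb (hmem p r)) (fun p r => ?_)
      (fun p => by rw [param_two_pi]) _ _
    refine ((hasDerivAt_zeroExt_param_q hg (hmem p r)).div_const _).congr_deriv ?_
    have hexact := mul_eq_add_of_isSigma_smul_slΛ hB h (hmem p r)
    rw [hinv p q r z hz, zeroExt_of_mem φ (hmem p r), div_eq_iff (by positivity)]
    linear_combination -hexact
  have hcont {p : ℝ} (hp : p ≠ 0) : Continuous fun t : ℝ × ℝ => zeroExt b (param p t.2 t.1) :=
    continuous_zeroExt_param hb continuous_const continuous_snd continuous_fst fun _ => Or.inl hp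
  have hlim : Continuous fun z => ∫ r in (0 : ℝ)..2 * Real.pi,
      (zeroExt b (param 1 r z) - zeroExt b (param (-1) r z)) :=
    intervalIntegral.continuous_parametric_intervalIntegral_of_continuous'
      ((hcont one_ne_zero).sub (hcont (neg_ne_zero.mpr one_ne_zero))) _ _
  refine ⟨_, ((hlim.tendsto 0).mono_left nhdsWithin_le_nhds).congr' ?_⟩
  filter_upwards [self_mem_nhdsWithin] with z hz using (hintegral hz).symm

/-- Minus the contraction of a bivector field with the annihilator of the leaves. It turns
`σ`-primitives of `φ • volField` into `σ`-primitives of `φ • slΛ`; the sign is there because this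
contraction anticommutes with `σ`. -/
def leafContraction (P : MVField slΩ 2) : MVField slΩ 1 :=
  fun x => -(P x).curryLeft (casimirCovector x)

theorem leafContraction_apply (P : MVField slΩ 2) (x : slΩ) (ξ : Fin 1 → Fin 3 → ℝ) :
    leafContraction P x ξ = -P x ![casimirCovector x, ξ 0] :=
  congrArg (fun v => -P x v) (by funext i; fin_cases i <;> rfl)

theorem isSmoothField_leafContraction {P : MVField slΩ 2} (hP : IsSmoothField P) :
    IsSmoothField (leafContraction P) := by
  intro ξ
  simp only [leafContraction_apply]
  exact (hP.vecCons isSmooth_casimirCovector ![ξ 0]).neg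

theorem isSigma_leafContraction {φ : FunRing slΩ} {P : MVField slΩ 2} (hP : IsSmoothField P)
    (h : IsSigma slΛ P (φ • volField)) : IsSigma slΛ (leafContraction P) (φ • slΛ) := by
  intro x ξ
  have hmoving (η ζ : Fin 3 → ℝ) :
      slΛ x ![η, dCov (fun y => P y ![casimirCovector y, ζ]) x]
        = slΛ x ![η, dCov (fun y => P y ![casimirCovector x, ζ]) x]
          + P x ![slBracket (casimirCovector x) η, ζ] := by
    rw [dCov_apply_vecCons hP isSmooth_casimirCovector ![ζ], lambda_add,
      apply_vecCons_eq_sum (P x) (slBracket _ _), slBracket_casimirCovector]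
    simp only [dCov_casimirCovector, Fin.sum_univ_three, lambda_add, lambda_smul]
    ring
  have hdCov (ζ : Fin 3 → ℝ) : dCov (fun y => leafContraction P y ![ζ]) x
      = -dCov (fun y => P y ![casimirCovector y, ζ]) x := by
    simp only [leafContraction_apply]
    exact dCov_neg (hP.vecCons isSmooth_casimirCovector ![ζ]) x
  have hneg (η ζ : Fin 3 → ℝ) : slΛ x ![η, -ζ] = -slΛ x ![η, ζ] := by
    rw [← neg_one_smul ℝ ζ, lambda_smul, neg_one_mul]
  have hσ := h x ![casimirCovector x, ξ 0, ξ 1]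
  rw [sigma_two_apply, MVField.smul_apply, ← slΛ_eq_volField] at hσ
  simp only [Matrix.cons_val, formBracket_slΛ, lambda_skew (Λ := slΛ) x (casimirCovector x),
    slΛ_casimirCovector] at hσ
  rw [sigma_one_apply, hdCov, hdCov, hneg, hneg, hmoving, hmoving, leafContraction_apply,
    formBracket_slΛ, show ξ = ![ξ 0, ξ 1] by funext i; fin_cases i <;> rfl, MVField.smul_apply]
  simp only [Matrix.cons_val]
  linear_combination hσ - lambda_skew (Λ := P) x (slBracket (ξ 0) (ξ 1)) (casimirCovector x)

/-- If `φ • E` is exact and `φ` is constant along the angles of the leaves, then the integrals of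
`φ` over arcs `p ∈ [-1, 1]` converge as the leaf approaches the nilpotent cone. This is the
obstruction that separates the classes of the form `[φ E]`. -/
def HasLimitObstruction {k : ℕ} (E : MVField slΩ (k + 1)) : Prop :=
  ∀ φ : FunRing slΩ, IsSmooth φ → IsAngleInvariant φ →
    ∀ Q : MVField slΩ k, IsSmoothField Q → IsSigma slΛ Q (φ • E) → ∀ q : ℝ, ∃ L : ℝ,
      Filter.Tendsto (fun z => ∫ s in (-1 : ℝ)..1, zeroExt φ (param s q z)) (𝓝[>] 0) (𝓝 L)

theorem hasLimitObstruction_hamX3 : HasLimitObstruction hamX3 :=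
  fun _ hφ _ _ hQ h => exists_tendsto_integral_of_isSigma_smul_hamX3 hφ hQ h

theorem hasLimitObstruction_slΛ : HasLimitObstruction slΛ := by
  intro φ _ hinv B hB h q
  obtain ⟨L, hL⟩ := exists_tendsto_integral_of_isSigma_smul_slΛ hinv hB h q
  refine ⟨(2 * Real.pi)⁻¹ * L, (hL.const_mul (2 * Real.pi)⁻¹).congr fun z => ?_⟩
  rw [intervalIntegral.integral_const_mul, inv_mul_cancel_left₀ Real.two_pi_pos.ne']

theorem hasLimitObstruction_volField : HasLimitObstruction volField :=
  fun φ hφ hinv _ hP h => hasLimitObstruction_slΛ φ hφ hinv _ (isSmoothField_leafContraction hP)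
    (isSigma_leafContraction hP h)

/-! ### Asymptotics of integrals along the leaves -/

theorem not_tendsto_sum_of_isLittleO {X ι : Type*} {l : Filter X} [l.NeBot] {s : Finset ι}
    {T : ι → X → ℝ} {i : ι} (hi : i ∈ s) (hone : (fun _ => (1 : ℝ)) =o[l] T i)
    (hT : ∀ j ∈ s, j ≠ i → T j =o[l] T i) (L : ℝ) :
    ¬ Filter.Tendsto (fun z => ∑ j ∈ s, T j z) l (𝓝 L) := by
  classical
  intro h
  have hsum : (fun z => ∑ j ∈ s, T j z) =o[l] T i := (h.isBigO_one ℝ).trans_isLittleO hone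
  have hrest : (fun z => ∑ j ∈ s.erase i, T j z) =o[l] T i :=
    Asymptotics.IsLittleO.fun_sum fun j hj =>
      hT j (Finset.mem_of_mem_erase hj) (Finset.ne_of_mem_erase hj)
  have hself : T i =o[l] T i := (hsum.sub hrest).congr_left fun z => by
    rw [← Finset.add_sum_erase s _ hi, add_sub_cancel_right]
  have hne : ∀ᶠ z in l, T i z ≠ 0 :=
    (((Asymptotics.isLittleO_one_left_iff ℝ).mp hone).eventually_gt_atTop 0).mono
      fun z hz => norm_pos_iff.mp hz
  exact Asymptotics.isLittleO_irrefl hne.frequently hself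

theorem eventuallyEq_zero_of_tendsto_sum {X ι : Type*} [LinearOrder ι] {l : Filter X} [l.NeBot]
    {s : Finset ι} {c F : ι → X → ℝ} (hc : ∀ i ∈ s, c i =O[l] fun _ => (1 : ℝ))
    (hdom : ∀ i ∈ s, c i =ᶠ[l] 0 ∨ ((fun _ => (1 : ℝ)) =o[l] (c i * F i) ∧
      ∀ j ∈ s, j < i → F j =o[l] (c i * F i)))
    {L : ℝ} (h : Filter.Tendsto (fun z => ∑ i ∈ s, c i z * F i z) l (𝓝 L)) :
    ∀ i ∈ s, c i =ᶠ[l] 0 := by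
  classical
  by_contra! hne
  obtain ⟨i₀, hi₀, hci₀⟩ := hne
  obtain ⟨i, hi, hmax⟩ := (s.filter fun i => ¬ c i =ᶠ[l] 0).exists_max_image id
    ⟨i₀, Finset.mem_filter.mpr ⟨hi₀, hci₀⟩⟩
  obtain ⟨his, hci⟩ := Finset.mem_filter.mp hi
  obtain ⟨hone, hlt⟩ := (hdom i his).resolve_left hci
  refine not_tendsto_sum_of_isLittleO (T := fun i => c i * F i) his hone (fun j hj hji => ?_) L h
  by_cases hcj : c j =ᶠ[l] 0
  · refine (Asymptotics.isLittleO_zero _ l).congr' ?_ Filter.EventuallyEq.rfl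
    filter_upwards [hcj] with z hz
    simp [hz]
  · have hji := (hmax j (Finset.mem_filter.mpr ⟨hj, hcj⟩)).lt_of_ne hji
    exact ((hc j hj).mul_isLittleO (hlt j hj hji)).congr_right fun z => one_mul _

theorem isLittleO_one_of_tendsto_atTop {X : Type*} {l : Filter X} {f : X → ℝ}
    (h : Filter.Tendsto f l Filter.atTop) : (fun _ => (1 : ℝ)) =o[l] f :=
  (Asymptotics.isLittleO_one_left_iff ℝ).mpr (tendsto_norm_atTop_atTop.comp h)

/-- The integral of the radial function with profile `ψ` along the arc `p ↦ param p q z`,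
`|p| ≤ 1`, on which `x₁² + x₂² + x₃² = 2 p² + z²`. -/
def leafIntegral (ψ : ℝ → ℝ) (z : ℝ) : ℝ := ∫ s in (-1 : ℝ)..1, ψ (2 * s ^ 2 + z ^ 2)

section LeafIntegral

variable {ψ χ : ℝ → ℝ} {z : ℝ}

theorem continuous_comp_two_mul_sq_add_sq (hψ : ContinuousOn ψ (Set.Ioi 0)) (hz : 0 < z) :
    Continuous fun s => ψ (2 * s ^ 2 + z ^ 2) :=
  hψ.comp_continuous (by fun_prop) fun s => Set.mem_Ioi.mpr (by positivity)

theorem leafIntegral_nonneg (h0 : ∀ y, 0 < y → 0 ≤ ψ y) (hz : 0 < z) : 0 ≤ leafIntegral ψ z :=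
  intervalIntegral.integral_nonneg (by norm_num) fun _ _ => h0 _ (by positivity)

theorem leafIntegral_le (hψ : ContinuousOn ψ (Set.Ioi 0)) (hanti : AntitoneOn ψ (Set.Ioi 0))
    (hz : 0 < z) : leafIntegral ψ z ≤ 2 * ψ (z ^ 2) := by
  calc leafIntegral ψ z ≤ ∫ _ in (-1 : ℝ)..1, ψ (z ^ 2) := by
        refine intervalIntegral.integral_mono_on (by norm_num)
          ((continuous_comp_two_mul_sq_add_sq hψ hz).intervalIntegrable _ _) (by simp) fun s _ => ?_
        exact hanti (Set.mem_Ioi.mpr (by positivity)) (Set.mem_Ioi.mpr (by positivity))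
          (le_add_of_nonneg_left (by positivity))
    _ = 2 * ψ (z ^ 2) := by
        rw [intervalIntegral.integral_const, smul_eq_mul]
        norm_num

theorem le_leafIntegral (hψ : ContinuousOn ψ (Set.Ioi 0)) (hanti : AntitoneOn ψ (Set.Ioi 0))
    (h0 : ∀ y, 0 < y → 0 ≤ ψ y) {δ : ℝ} (hz : 0 < z) (hδ : 0 ≤ δ) (hδz : δ * z ≤ 1) :
    δ * z * ψ ((1 + 2 * δ ^ 2) * z ^ 2) ≤ leafIntegral ψ z := by
  have hcont := continuous_comp_two_mul_sq_add_sq hψ hz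
  have hδz0 : 0 ≤ δ * z := by positivity
  calc δ * z * ψ ((1 + 2 * δ ^ 2) * z ^ 2)
      = ∫ _ in (0 : ℝ)..(δ * z), ψ ((1 + 2 * δ ^ 2) * z ^ 2) := by simp
    _ ≤ ∫ s in (0 : ℝ)..(δ * z), ψ (2 * s ^ 2 + z ^ 2) := by
        refine intervalIntegral.integral_mono_on hδz0 (by simp) (hcont.intervalIntegrable _ _)
          fun s hs => ?_
        refine hanti (Set.mem_Ioi.mpr (by positivity)) (Set.mem_Ioi.mpr (by positivity)) ?_
        linear_combination 2 * pow_le_pow_left₀ hs.1 hs.2 2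
    _ ≤ leafIntegral ψ z :=
        intervalIntegral.integral_mono_interval (by norm_num) hδz0 hδz
          (Filter.Eventually.of_forall fun s => h0 _ (by positivity)) (hcont.intervalIntegrable _ _)

theorem exists_norm_le_mul_add_of_isLittleO (hψ : ContinuousOn ψ (Set.Ioi 0))
    (h0 : ∀ y, 0 < y → 0 ≤ χ y) (h : ψ =o[𝓝[>] 0] χ) {ε : ℝ} (hε : 0 < ε) (b : ℝ) :
    ∃ C, ∀ y ∈ Set.Ioc 0 b, ‖ψ y‖ ≤ ε * χ y + C := by
  obtain ⟨r, hr, hnear⟩ := mem_nhdsGT_iff_exists_Ioo_subset.mp (h.def hε)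
  obtain ⟨C, hC⟩ := isCompact_Icc.exists_bound_of_continuousOn
    (hψ.mono fun y (hy : y ∈ Set.Icc r b) => Set.mem_Ioi.mpr (lt_of_lt_of_le hr hy.1))
  refine ⟨max C 0, fun y hy => ?_⟩
  rcases lt_or_ge y r with hyr | hyr
  · have hbound : ‖ψ y‖ ≤ ε * ‖χ y‖ := hnear ⟨hy.1, hyr⟩
    rw [Real.norm_of_nonneg (h0 y hy.1)] at hbound
    exact hbound.trans (le_add_of_nonneg_right (le_max_right _ _))
  · have hnonneg := mul_nonneg hε.le (h0 y hy.1)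
    exact ((hC y ⟨hyr, hy.2⟩).trans (le_max_left _ _)).trans (le_add_of_nonneg_left hnonneg)

theorem leafIntegral_isLittleO (hψ : ContinuousOn ψ (Set.Ioi 0)) (hχ : ContinuousOn χ (Set.Ioi 0))
    (h0 : ∀ y, 0 < y → 0 ≤ χ y) (h : ψ =o[𝓝[>] 0] χ)
    (htop : Filter.Tendsto (leafIntegral χ) (𝓝[>] 0) Filter.atTop) :
    leafIntegral ψ =o[𝓝[>] 0] leafIntegral χ := by
  refine Asymptotics.IsLittleO.of_bound fun ε hε => ?_
  obtain ⟨C, hC⟩ := exists_norm_le_mul_add_of_isLittleO hψ h0 h (half_pos hε) 3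
  filter_upwards [Ioc_mem_nhdsGT (zero_lt_one' ℝ), htop.eventually_ge_atTop (2 * (2 * C) / ε)]
    with z ⟨hz, hz1⟩ hlarge
  have hint := ((continuous_comp_two_mul_sq_add_sq hχ hz).const_mul (ε / 2)).intervalIntegrable
    (μ := MeasureTheory.volume) (-1) 1
  have hconst : IntervalIntegrable (fun _ => C) MeasureTheory.volume (-1) 1 := by simp
  rw [Real.norm_of_nonneg (leafIntegral_nonneg h0 hz)]
  rw [div_le_iff₀ hε] at hlarge
  calc ‖leafIntegral ψ z‖ ≤ ∫ s in (-1 : ℝ)..1, (ε / 2 * χ (2 * s ^ 2 + z ^ 2) + C) := by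
        refine intervalIntegral.norm_integral_le_of_norm_le (by norm_num)
          (Filter.Eventually.of_forall fun s hs => hC _ ⟨by positivity, ?_⟩) (hint.add hconst)
        nlinarith [hs.1, hs.2]
    _ = ε / 2 * leafIntegral χ z + 2 * C := by
        rw [intervalIntegral.integral_add hint hconst, intervalIntegral.integral_const_mul,
          intervalIntegral.integral_const, leafIntegral, smul_eq_mul]
        norm_num
    _ ≤ ε * leafIntegral χ z := by linarith

end LeafIntegral

theorem powProfile_nonneg (α : ℝ) {y : ℝ} (hy : 0 < y) : 0 ≤ powProfile α y := by
  unfold powProfile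
  positivity

theorem expProfile_nonneg (α y : ℝ) : 0 ≤ expProfile α y := by
  unfold expProfile
  positivity

theorem antitoneOn_powProfile {α : ℝ} (hα : 0 ≤ α) : AntitoneOn (powProfile α) (Set.Ioi 0) :=
  fun _ ha _ _ hab => one_div_le_one_div_of_le (Real.rpow_pos_of_pos ha α)
    (Real.rpow_le_rpow (le_of_lt ha) hab hα)

theorem antitoneOn_expProfile {α : ℝ} (hα : 0 ≤ α) : AntitoneOn (expProfile α) (Set.Ioi 0) := by
  intro a (ha : 0 < a) b _ hab
  unfold expProfile
  gcongr

theorem powProfile_mul_sq (α : ℝ) {d z : ℝ} (hd : 0 ≤ d) (hz : 0 < z) :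
    powProfile α (d * z ^ 2) = powProfile α d * z⁻¹ ^ (2 * α) := by
  rw [powProfile, powProfile, Real.mul_rpow hd (by positivity), ← Real.rpow_natCast_mul hz.le,
    Real.inv_rpow hz.le]
  push_cast
  rw [one_div, one_div, mul_inv]

theorem tendsto_leafIntegral_powProfile_atTop {α : ℝ} (hα : 1 / 2 < α) :
    Filter.Tendsto (leafIntegral (powProfile α)) (𝓝[>] 0) Filter.atTop := by
  have hlower : Filter.Tendsto (fun z : ℝ => powProfile α 3 * z⁻¹ ^ (2 * α - 1)) (𝓝[>] 0)
      Filter.atTop :=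
    ((tendsto_rpow_atTop (by linarith)).comp tendsto_inv_nhdsGT_zero).const_mul_atTop
      (one_div_pos.mpr (by positivity))
  refine Filter.tendsto_atTop_mono' _ ?_ hlower
  filter_upwards [Ioc_mem_nhdsGT (zero_lt_one' ℝ)] with z ⟨hz, hz1⟩
  calc powProfile α 3 * z⁻¹ ^ (2 * α - 1)
      = 1 * z * powProfile α ((1 + 2 * 1 ^ 2) * z ^ 2) := by
        rw [powProfile_mul_sq α (by norm_num) hz, Real.rpow_sub_one (inv_ne_zero hz.ne')]
        norm_num
        ring
    _ ≤ leafIntegral (powProfile α) z :=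
        le_leafIntegral (contDiffOn_powProfile α).continuousOn (antitoneOn_powProfile (by linarith))
          (fun y => powProfile_nonneg α) hz zero_le_one (by rwa [one_mul])

theorem powProfile_isLittleO {β α : ℝ} (hβα : β < α) :
    powProfile β =o[𝓝[>] 0] powProfile α := by
  have hsmall : Filter.Tendsto (fun y : ℝ => y ^ (α - β)) (𝓝[>] 0) (𝓝 0) := by
    have h := (Real.continuousAt_rpow_const 0 (α - β) (Or.inr (by linarith))).tendsto
    rw [Real.zero_rpow (by linarith)] at h
    exact h.mono_left nhdsWithin_le_nhds
  refine Asymptotics.isLittleO_iff_exists_eq_mul.mpr ⟨_, hsmall, ?_⟩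
  filter_upwards [self_mem_nhdsWithin] with y (hy : 0 < y)
  simp only [Pi.mul_apply, powProfile, Real.rpow_sub hy]
  field_simp

theorem leafIntegral_powProfile_isLittleO {β α : ℝ} (hβα : β < α) (hα : 1 / 2 < α) :
    leafIntegral (powProfile β) =o[𝓝[>] 0] leafIntegral (powProfile α) :=
  leafIntegral_isLittleO (contDiffOn_powProfile β).continuousOn
    (contDiffOn_powProfile α).continuousOn (fun _ => powProfile_nonneg α)
    (powProfile_isLittleO hβα) (tendsto_leafIntegral_powProfile_atTop hα)

theorem tendsto_inv_pow_mul_exp_neg_div_sq {γ : ℝ} (hγ : 0 < γ) (k : ℕ) :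
    Filter.Tendsto (fun z : ℝ => z⁻¹ ^ k * Real.exp (-(γ / z ^ 2))) (𝓝[>] 0) (𝓝 0) := by
  have h := (rpow_mul_exp_neg_mul_sq_isLittleO_exp_neg hγ k).tendsto_zero_of_tendsto
    (Real.tendsto_exp_atBot.comp (Filter.tendsto_id.const_mul_atTop_of_neg (by norm_num)))
  refine (h.comp tendsto_inv_nhdsGT_zero).congr fun z => ?_
  simp [div_eq_mul_inv]

/-- Replacing the profile parameter `β` by any larger `α / D` gains every power of `z`. -/
theorem expProfile_sq_isLittleO {β α D : ℝ} (hD : 0 < D) (h : β < α / D) (k : ℕ) :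
    (fun z => expProfile β (z ^ 2)) =o[𝓝[>] 0] fun z => z ^ k * expProfile α (D * z ^ 2) := by
  have hsmall := (tendsto_inv_pow_mul_exp_neg_div_sq (sub_pos.mpr h) k).const_mul (D ^ 2)
  rw [mul_zero] at hsmall
  refine Asymptotics.isLittleO_iff_exists_eq_mul.mpr ⟨_, hsmall, ?_⟩
  filter_upwards [self_mem_nhdsWithin] with z (hz : 0 < z)
  have hexp : Real.exp (β / z ^ 2)
      = Real.exp (-((α / D - β) / z ^ 2)) * Real.exp (α / (D * z ^ 2)) := by
    rw [← Real.exp_add]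
    congr 1
    field_simp
    ring
  simp only [Pi.mul_apply, expProfile, hexp, inv_pow]
  field_simp

theorem leafIntegral_expProfile_isBigO {β : ℝ} (hβ : 0 ≤ β) :
    leafIntegral (expProfile β) =O[𝓝[>] 0] fun z => expProfile β (z ^ 2) := by
  refine Asymptotics.IsBigO.of_bound 2 ?_
  filter_upwards [self_mem_nhdsWithin] with z (hz : 0 < z)
  rw [Real.norm_of_nonneg (expProfile_nonneg β _),
    Real.norm_of_nonneg (leafIntegral_nonneg (fun y _ => expProfile_nonneg β y) hz)]
  exact leafIntegral_le (contDiffOn_expProfile β).continuousOn (antitoneOn_expProfile hβ) hz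

theorem expProfile_isBigO_leafIntegral {α δ : ℝ} (hα : 0 ≤ α) (hδ : 0 < δ) :
    (fun z => z * expProfile α ((1 + 2 * δ ^ 2) * z ^ 2)) =O[𝓝[>] 0]
      leafIntegral (expProfile α) := by
  refine Asymptotics.IsBigO.of_bound δ⁻¹ ?_
  filter_upwards [Ioc_mem_nhdsGT (inv_pos.mpr hδ)] with z ⟨hz, hzδ⟩
  rw [Real.norm_of_nonneg (leafIntegral_nonneg (fun y _ => expProfile_nonneg α y) hz),
    Real.norm_of_nonneg (mul_nonneg hz.le (expProfile_nonneg α _)), ← div_eq_inv_mul,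
    le_div_iff₀' hδ, ← mul_assoc]
  refine le_leafIntegral (contDiffOn_expProfile α).continuousOn (antitoneOn_expProfile hα)
    (fun y _ => expProfile_nonneg α y) hz hδ.le ?_
  rwa [← le_div_iff₀' hδ, one_div]

theorem leafIntegral_expProfile_isLittleO {β α : ℝ} (hβ : 0 ≤ β) (hβα : β < α) (m : ℕ) :
    leafIntegral (expProfile β) =o[𝓝[>] 0] fun z => z ^ m * leafIntegral (expProfile α) z := by
  obtain ⟨δ, hδα, hδ⟩ : ∃ δ : ℝ, β < α / (1 + 2 * δ ^ 2) ∧ 0 < δ := by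
    have hcont : Continuous fun δ : ℝ => α / (1 + 2 * δ ^ 2) :=
      continuous_const.div (by fun_prop) fun δ => by positivity
    have hlim := (hcont.tendsto 0).mono_left (nhdsWithin_le_nhds (s := Set.Ioi 0))
    exact ((hlim.eventually_const_lt (by simpa using hβα)).and self_mem_nhdsWithin).exists
  refine ((leafIntegral_expProfile_isBigO hβ).trans_isLittleO
    (expProfile_sq_isLittleO (by positivity) hδα (m + 1))).trans_isBigO ?_
  refine ((Asymptotics.isBigO_refl (fun z : ℝ => z ^ m) (𝓝[>] 0)).mul
    (expProfile_isBigO_leafIntegral (hβ.trans hβα.le) hδ)).congr_left fun z => ?_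
  rw [pow_succ z m, mul_assoc]

theorem one_isLittleO_pow_mul_leafIntegral_expProfile {α : ℝ} (hα : 0 < α) (m : ℕ) :
    (fun _ => (1 : ℝ)) =o[𝓝[>] 0] fun z => z ^ m * leafIntegral (expProfile α) z := by
  have hzero : powProfile 2 = expProfile 0 := by
    funext y
    simp [powProfile, expProfile]
  have htop := tendsto_leafIntegral_powProfile_atTop (α := 2) (by norm_num)
  rw [hzero] at htop
  exact (isLittleO_one_of_tendsto_atTop htop).trans (leafIntegral_expProfile_isLittleO le_rfl hα m)

/-! ### Casimir functions as functions of the leaf -/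

/-- The value of a Casimir function on the leaf `x₁² + x₂² - x₃² = z²`, as a function of `z > 0`. -/
def leafValue (c : slΩ → ℝ) (z : ℝ) : ℝ := zeroExt c (param 0 0 z)

theorem exists_cos_eq_sin_eq {a b : ℝ} (h : a ^ 2 + b ^ 2 = 1) :
    ∃ θ : ℝ, Real.cos θ = a ∧ Real.sin θ = b := by
  have hnorm : ‖(⟨a, b⟩ : ℂ)‖ = 1 := by rw [Complex.norm_eq_sqrt_sq_add_sq, h, Real.sqrt_one]
  have hne : (⟨a, b⟩ : ℂ) ≠ 0 := norm_ne_zero_iff.mp (by simp [hnorm])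
  exact ⟨Complex.arg ⟨a, b⟩, by rw [Complex.cos_arg hne, hnorm, div_one],
    by rw [Complex.sin_arg, hnorm, div_one]⟩

theorem exists_eq_param {x : Fin 3 → ℝ} {z : ℝ} (hz : 0 < z)
    (h : x 0 ^ 2 + x 1 ^ 2 - x 2 ^ 2 = z ^ 2) : ∃ q, x = param (x 2) q z := by
  have hne : x 2 ^ 2 + z ^ 2 ≠ 0 := by positivity
  obtain ⟨q, hcos, hsin⟩ := exists_cos_eq_sin_eq
    (a := (x 0 * z - x 1 * x 2) / (x 2 ^ 2 + z ^ 2))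
    (b := -(x 0 * x 2 + x 1 * z) / (x 2 ^ 2 + z ^ 2)) (by
      field_simp
      linear_combination (x 2 ^ 2 + z ^ 2) * h)
  refine ⟨q, ?_⟩
  rw [param, hcos, hsin]
  funext i
  fin_cases i
  · simp only [Fin.zero_eta, Matrix.cons_val_zero]
    field_simp
    ring
  · simp only [Fin.mk_one, Matrix.cons_val_one, Matrix.cons_val_zero]
    field_simp
    ring
  · rfl

theorem casimir_apply_eq_leafValue {c : FunRing slΩ} (hc : c ∈ casimirs slΛ) (x : slΩ)
    (hx : 0 < x.1 0 ^ 2 + x.1 1 ^ 2 - x.1 2 ^ 2) :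
    c x = leafValue c √(x.1 0 ^ 2 + x.1 1 ^ 2 - x.1 2 ^ 2) := by
  have hz := Real.sqrt_pos.mpr hx
  obtain ⟨q, hq⟩ := exists_eq_param hz (Real.sq_sqrt hx.le).symm
  calc c x = zeroExt c x.1 := (zeroExt_apply c x).symm
    _ = zeroExt c (param (x.1 2) q _) := congrArg (zeroExt c) hq
    _ = leafValue c _ := casimir_param hc hz _ _ 0 0

theorem exists_analyticAt_eventuallyEq_leafValue {c : casimirs slΛ} (hc : c ∈ invAnalytic) :
    ∃ f : ℝ → ℝ, AnalyticAt ℝ f 0 ∧ leafValue c.1 =ᶠ[𝓝[>] 0] f := by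
  obtain ⟨F, hF, -, hcF⟩ := hc
  have hparam : AnalyticAt ℝ (param 0 0) 0 := by
    refine analyticAt_pi_iff.mpr fun j => ?_
    fin_cases j
    · suffices AnalyticAt ℝ (fun z : ℝ => z) 0 by simpa [param] using this
      exact analyticAt_id
    all_goals simp [param, analyticAt_const]
  refine ⟨F ∘ param 0 0, (hF _ (Set.mem_univ _)).comp hparam, ?_⟩
  filter_upwards [self_mem_nhdsWithin] with z (hz : 0 < z)
  have hmem : param 0 0 z ∈ slΩ := param_mem (Or.inr hz.ne')
  exact (zeroExt_of_mem _ hmem).trans (hcF ⟨_, hmem⟩)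

theorem eq_zero_of_mem_invAnalytic {c : casimirs slΛ} (hc : c ∈ invAnalytic)
    (h : leafValue c.1 =ᶠ[𝓝[>] 0] 0) : c = 0 := by
  obtain ⟨F, hF, -, hcF⟩ := hc
  obtain ⟨ε, hε : 0 < ε, hzero⟩ := mem_nhdsGT_iff_exists_Ioo_subset.mp h
  have hopen : IsOpen {x : Fin 3 → ℝ | 0 < x 0 ^ 2 + x 1 ^ 2 - x 2 ^ 2 ∧
      x 0 ^ 2 + x 1 ^ 2 - x 2 ^ 2 < ε ^ 2} :=
    IsOpen.and (isOpen_lt (by fun_prop) (by fun_prop)) (isOpen_lt (by fun_prop) (by fun_prop))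
  have hbase : 0 < (ε / 2) ^ 2 + 0 ^ 2 - 0 ^ 2 ∧ (ε / 2) ^ 2 + 0 ^ 2 - 0 ^ 2 < ε ^ 2 :=
    ⟨by nlinarith, by nlinarith⟩
  have hnear : F =ᶠ[𝓝 (![ε / 2, 0, 0] : Fin 3 → ℝ)] 0 := by
    refine Filter.eventually_of_mem (hopen.mem_nhds hbase) fun x ⟨hpos, hlt⟩ => ?_
    have hx : x ∈ slΩ := by
      rintro rfl
      simp at hpos
    rw [← hcF ⟨x, hx⟩, casimir_apply_eq_leafValue c.2 ⟨x, hx⟩ hpos]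
    exact hzero ⟨Real.sqrt_pos.mpr hpos, (Real.sqrt_lt' hε).mpr hlt⟩
  have hF0 : Set.EqOn F 0 Set.univ := hF.eqOn_of_preconnected_of_eventuallyEq
    analyticOnNhd_const isPreconnected_univ (Set.mem_univ _) hnear
  exact Subtype.ext (funext fun x => (hcF x).trans (hF0 (Set.mem_univ _)))

theorem invPoly_le_invAnalytic : invPoly ≤ invAnalytic := by
  rintro c ⟨p, hp, hcp⟩
  exact ⟨fun μ => MvPolynomial.eval μ p, AnalyticOnNhd.eval_mvPolynomial p, hp, hcp⟩

theorem eventuallyEq_zero_or_pow_isBigO_of_analyticAt {f : ℝ → ℝ} {z₀ : ℝ}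
    (hf : AnalyticAt ℝ f z₀) :
    f =ᶠ[𝓝 z₀] 0 ∨ ∃ m : ℕ, (fun z => (z - z₀) ^ m) =O[𝓝 z₀] f := by
  refine or_iff_not_imp_left.mpr fun hf0 => ?_
  obtain ⟨m, u, hu, hu0, hfu⟩ := hf.exists_eventuallyEq_pow_smul_nonzero_iff.mpr hf0
  have hone : (fun _ => u z₀) =O[𝓝 z₀] u :=
    ((Asymptotics.isEquivalent_const_iff_tendsto hu0).mpr hu.continuousAt).isBigO_symm
  have hmul := (Asymptotics.isBigO_refl (fun z => (z - z₀) ^ m) (𝓝 z₀)).mul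
    ((Asymptotics.isBigO_const_const (1 : ℝ) hu0 _).trans hone)
  simp only [mul_one] at hmul
  exact ⟨m, hmul.trans_eventuallyEq (Filter.EventuallyEq.symm hfu)⟩

theorem leafValue_isBigO_one {c : casimirs slΛ} (hc : c ∈ invAnalytic) :
    leafValue c.1 =O[𝓝[>] 0] fun _ => (1 : ℝ) := by
  obtain ⟨f, hf, hcf⟩ := exists_analyticAt_eventuallyEq_leafValue hc
  exact hcf.trans_isBigO ((hf.continuousAt.tendsto.mono_left nhdsWithin_le_nhds).isBigO_one ℝ)

theorem leafValue_eventuallyEq_zero_or_pow_isBigO {c : casimirs slΛ} (hc : c ∈ invAnalytic) :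
    leafValue c.1 =ᶠ[𝓝[>] 0] 0 ∨ ∃ m : ℕ, (fun z => z ^ m) =O[𝓝[>] 0] leafValue c.1 := by
  obtain ⟨f, hf, hcf⟩ := exists_analyticAt_eventuallyEq_leafValue hc
  refine (eventuallyEq_zero_or_pow_isBigO_of_analyticAt hf).imp
    (fun hf0 => hcf.trans (hf0.filter_mono nhdsWithin_le_nhds)) fun ⟨m, hm⟩ => ⟨m, ?_⟩
  simp only [sub_zero] at hm
  exact (hm.mono nhdsWithin_le_nhds).trans_eventuallyEq hcf.symm

theorem leafValue_algebraMap (r : ℝ) {z : ℝ} (hz : 0 < z) :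
    leafValue (algebraMap ℝ (casimirs slΛ) r).1 z = r :=
  zeroExt_of_mem _ (param_mem (Or.inr hz.ne'))

/-! ### Linear independence -/

theorem zeroExt_radial_param (ψ : ℝ → ℝ) (p q : ℝ) {z : ℝ} (hz : 0 < z) :
    zeroExt (radial ψ) (param p q z) = ψ (2 * p ^ 2 + z ^ 2) :=
  (zeroExt_of_mem _ (param_mem (Or.inr hz.ne'))).trans (congrArg ψ (normSq3_param p q z))

/-- The coefficient `∑ gᵢ ψᵢ(x₁² + x₂² + x₃²)` of a combination of classes `[ψᵢ(x₁² + x₂² + x₃²) E]`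
over the Casimir functions. -/
def casimirCombination {ι : Type*} (s : Finset ι) (g : ι → casimirs slΛ) (ψ : ι → ℝ → ℝ) :
    FunRing slΩ := ∑ i ∈ s, (g i).1 * radial (ψ i)

section Combination

variable {ι : Type*} {s : Finset ι} {g : ι → casimirs slΛ} {ψ : ι → ℝ → ℝ}

theorem casimirCombination_apply (x : slΩ) :
    casimirCombination s g ψ x = ∑ i ∈ s, (g i).1 x * radial (ψ i) x :=
  Finset.sum_apply x s fun i => ((g i).1 * radial (ψ i) : slΩ → ℝ)

theorem zeroExt_casimirCombination_param (p q : ℝ) {z : ℝ} (hz : 0 < z) :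
    zeroExt (casimirCombination s g ψ) (param p q z)
      = ∑ i ∈ s, leafValue (g i).1 z * ψ i (2 * p ^ 2 + z ^ 2) := by
  have hmem : param p q z ∈ slΩ := param_mem (Or.inr hz.ne')
  refine ((zeroExt_of_mem _ hmem).trans (casimirCombination_apply _)).trans
    (Finset.sum_congr rfl fun i _ => congrArg₂ (· * ·) ?_ ?_)
  · exact (zeroExt_of_mem _ hmem).symm.trans (casimir_param (g i).2 hz p q 0 0)
  · exact (zeroExt_of_mem _ hmem).symm.trans (zeroExt_radial_param (ψ i) p q hz)

theorem isSmooth_casimirCombination (hψ : ∀ i, ContDiffOn ℝ ∞ (ψ i) (Set.Ioi 0)) :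
    IsSmooth (casimirCombination s g ψ) := by
  rw [show casimirCombination s g ψ = _ from funext casimirCombination_apply]
  exact IsSmooth.sum s fun i _ => (g i).2.1.mul (isSmooth_radial (hψ i))

theorem isAngleInvariant_casimirCombination : IsAngleInvariant (casimirCombination s g ψ) :=
  fun p q q' _ hz => by
    rw [zeroExt_casimirCombination_param p q hz, zeroExt_casimirCombination_param p q' hz]

theorem integral_casimirCombination_param (hψ : ∀ i, ContDiffOn ℝ ∞ (ψ i) (Set.Ioi 0)) (q : ℝ)
    {z : ℝ} (hz : 0 < z) :
    ∫ p in (-1 : ℝ)..1, zeroExt (casimirCombination s g ψ) (param p q z)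
      = ∑ i ∈ s, leafValue (g i).1 z * leafIntegral (ψ i) z := by
  simp only [zeroExt_casimirCombination_param _ _ hz]
  rw [intervalIntegral.integral_finsetSum fun i _ => ((continuous_comp_two_mul_sq_add_sq
    (hψ i).continuousOn hz).const_mul _).intervalIntegrable _ _]
  simp only [intervalIntegral.integral_const_mul, leafIntegral]

end Combination

section Independence

variable {C : (k : ℕ) → Submodule (casimirs slΛ) (MVField slΩ k)} {k : ℕ}
  {E : MVField slΩ (k + 1)} {ι : Type*} {a : ι → ℝ}

theorem HasLimitObstruction.exists_tendsto_sum (hE : HasLimitObstruction E) {s : Finset ι}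
    {g : ι → casimirs slΛ} {ψ : ι → ℝ → ℝ} (hψ : ∀ i, ContDiffOn ℝ ∞ (ψ i) (Set.Ioi 0))
    {hQ : ∀ i, radial (ψ i) • E ∈ cocycles slΛ C (k + 1)}
    (h : ∑ i ∈ s, g i • cohomologyClass slΛ C (k + 1) ⟨radial (ψ i) • E, hQ i⟩ = 0) :
    ∃ L : ℝ, Filter.Tendsto (fun z => ∑ i ∈ s, leafValue (g i).1 z * leafIntegral (ψ i) z)
      (𝓝[>] 0) (𝓝 L) := by
  have hsum : ∑ i ∈ s, g i • (radial (ψ i) • E) = casimirCombination s g ψ • E := by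
    rw [casimirCombination, Finset.sum_smul]
    exact Finset.sum_congr rfl fun i _ => (mul_smul (g i).1 (radial (ψ i)) E).symm
  have hexact := sum_smul_mem_coboundaries h
  rw [hsum] at hexact
  obtain ⟨-, Q, -, hQsmooth, hσ⟩ := hexact
  obtain ⟨L, hL⟩ := hE _ (isSmooth_casimirCombination hψ) isAngleInvariant_casimirCombination
    Q hQsmooth hσ 0
  refine ⟨L, hL.congr' ?_⟩
  filter_upwards [self_mem_nhdsWithin] with z hz using integral_casimirCombination_param hψ 0 hz

variable [LinearOrder ι]

theorem linearIndependent_powProfile (hE : HasLimitObstruction E) (ha : StrictMono a)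
    (ha0 : ∀ i, 1 / 2 < a i)
    (hQ : ∀ i, radial (powProfile (a i)) • E ∈ cocycles slΛ C (k + 1)) :
    LinearIndependent ℝ fun i => cohomologyClass slΛ C (k + 1) ⟨_, hQ i⟩ := by
  refine linearIndependent_iff'.mpr fun s r h => ?_
  obtain ⟨L, hL⟩ := hE.exists_tendsto_sum (g := fun i => algebraMap ℝ _ (r i))
    (fun i => contDiffOn_powProfile (a i)) h
  have hL' : Filter.Tendsto (fun z => ∑ i ∈ s, r i * leafIntegral (powProfile (a i)) z)
      (𝓝[>] 0) (𝓝 L) := by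
    refine hL.congr' ?_
    filter_upwards [self_mem_nhdsWithin] with z hz
    simp only [leafValue_algebraMap _ hz]
  have hzero := eventuallyEq_zero_of_tendsto_sum (c := fun i _ => r i)
    (fun i _ => Asymptotics.isBigO_const_const _ one_ne_zero _) (fun i _ => ?_) hL'
  · exact fun i hi => (hzero i hi).exists.choose_spec
  rcases eq_or_ne (r i) 0 with hr | hr
  · exact Or.inl (Filter.Eventually.of_forall fun _ => hr)
  have hmul : leafIntegral (powProfile (a i)) =O[𝓝[>] 0]
      ((fun _ => r i) * leafIntegral (powProfile (a i))) :=
    (Asymptotics.isBigO_refl _ _).const_mul_right hr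
  exact Or.inr ⟨(isLittleO_one_of_tendsto_atTop (tendsto_leafIntegral_powProfile_atTop
    (ha0 i))).trans_isBigO hmul, fun j _ hji =>
    (leafIntegral_powProfile_isLittleO (ha hji) (ha0 i)).trans_isBigO hmul⟩

theorem linearIndependent_invAnalytic_expProfile (hE : HasLimitObstruction E) (ha : StrictMono a)
    (ha0 : ∀ i, 0 < a i)
    (hQ : ∀ i, radial (expProfile (a i)) • E ∈ cocycles slΛ C (k + 1)) :
    LinearIndependent invAnalytic fun i => cohomologyClass slΛ C (k + 1) ⟨_, hQ i⟩ := by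
  refine linearIndependent_iff'.mpr fun s g h => ?_
  obtain ⟨L, hL⟩ := hE.exists_tendsto_sum (g := fun i => (g i).1)
    (fun i => contDiffOn_expProfile (a i)) h
  have hzero := eventuallyEq_zero_of_tendsto_sum (fun i _ => leafValue_isBigO_one (g i).2)
    (fun i _ => ?_) hL
  · exact fun i hi => Subtype.ext (eq_zero_of_mem_invAnalytic (g i).2 (hzero i hi))
  refine (leafValue_eventuallyEq_zero_or_pow_isBigO (g i).2).imp_right fun ⟨m, hm⟩ => ?_
  have hmul := hm.mul (Asymptotics.isBigO_refl (leafIntegral (expProfile (a i))) (𝓝[>] 0))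
  exact ⟨(one_isLittleO_pow_mul_leafIntegral_expProfile (ha0 i) m).trans_isBigO hmul,
    fun j _ hji =>
      (leafIntegral_expProfile_isLittleO (ha0 j).le (ha hji) m).trans_isBigO hmul⟩

end Independence

section Scalars

variable {H : Type} [AddCommGroup H] [Module ℝ H] [Module (casimirs slΛ) H]

instance : Nontrivial (casimirs slΛ) := by
  refine ⟨0, 1, fun h => zero_ne_one (α := ℝ) ?_⟩
  exact congrArg (fun c : casimirs slΛ => c.1 ⟨param 1 0 0, param_mem (Or.inl one_ne_zero)⟩) h

theorem linearIndependent_of_invAnalytic [IsScalarTower ℝ (casimirs slΛ) H] {ι : Type*} {v : ι → H}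
    (h : LinearIndependent invAnalytic v) :
    LinearIndependent ℝ v ∧ LinearIndependent invPoly v ∧ LinearIndependent invAnalytic v := by
  refine ⟨h.restrict_scalars' ℝ, linearIndependent_iff'.mpr fun s g hg i hi => ?_, h⟩
  have hzero := linearIndependent_iff'.mp h s
    (fun i => Subalgebra.inclusion invPoly_le_invAnalytic (g i)) hg i hi
  exact (map_eq_zero_iff _ (Subalgebra.inclusion_injective invPoly_le_invAnalytic)).mp hzero

theorem isInfiniteDim_of_linearIndependent [IsScalarTower ℝ (casimirs slΛ) H] {ι : Type*}
    [Infinite ι] {v : ι → H} (h : LinearIndependent invAnalytic v) : IsInfiniteDim H := by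
  obtain ⟨hℝ, hPoly, hAnalytic⟩ := linearIndependent_of_invAnalytic h
  exact ⟨fun _ => Module.Finite.not_linearIndependent_of_infinite v hℝ,
    fun _ => Module.Finite.not_linearIndependent_of_infinite v hPoly,
    fun _ => Module.Finite.not_linearIndependent_of_infinite v hAnalytic⟩

end Scalars

theorem HasLimitObstruction.isInfiniteDim_cohomology
    {C : (k : ℕ) → Submodule (casimirs slΛ) (MVField slΩ k)} {k : ℕ} {E : MVField slΩ (k + 1)}
    (hE : HasLimitObstruction E)
    (hQ : ∀ α : Set.Ioi (0 : ℝ), radial (expProfile α) • E ∈ cocycles slΛ C (k + 1)) :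
    IsInfiniteDim (Cohomology slΛ C (k + 1)) :=
  have : Infinite (Set.Ioi (0 : ℝ)) := (Set.Ioi_infinite 0).to_subtype
  isInfiniteDim_of_linearIndependent (ι := Set.Ioi (0 : ℝ))
    (linearIndependent_invAnalytic_expProfile hE (Subtype.strictMono_coe _) Subtype.prop hQ)

end PoissonTP

end

open PoissonTP in
theorem mainTheorem12 :
    -- H⁰_tan = I(Ω), and Hᵏ_tan = 0 for k > 2
    Nonempty (HTan slΛ 0 ≃ₗ[casimirs slΛ] casimirs slΛ) ∧
    (∀ k : ℕ, 2 < k → Subsingleton (HTan slΛ k)) ∧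
    -- limit obstruction in degree 1
    (∀ a f : slΩ → ℝ, IsSmooth a → IsSmooth f → IsSigma slΛ (ofFun f) (aH3 a) →
      ∀ q : ℝ, ∃ L : ℝ, Filter.Tendsto (fun z => ∫ s in (-1 : ℝ)..1, zeroExt a (param s q z))
        (𝓝[>] 0) (𝓝 L)) ∧
    -- limit obstruction in degree 2
    (∀ φ : slΩ → ℝ, IsSmooth φ →
      (∀ p q q' z : ℝ, 0 < z → zeroExt φ (param p q z) = zeroExt φ (param p q' z)) →
      (∃ B ∈ tangentialFields slΛ 1, IsSigma slΛ B (mulΛ φ)) →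
      ∀ q : ℝ, ∃ L : ℝ, Filter.Tendsto
        (fun z => ∫ s in (-1 : ℝ)..1, 2 * Real.pi * zeroExt φ (param s q z)) (𝓝[>] 0) (𝓝 L)) ∧
    -- explicit families in degree 1
    (∃ hT : ∀ α : Set.Ioi (1 / 2 : ℝ), aH3 (tHat α) ∈ cocycles slΛ (tangentialFields slΛ) 1,
      LinearIndependent ℝ (fun α : Set.Ioi (1 / 2 : ℝ) =>
        tanClass slΛ 1 ⟨aH3 (tHat α), hT α⟩)) ∧
    (∃ hK : ∀ α : Set.Ioi (1 / 2 : ℝ), aH3 (kHat α) ∈ cocycles slΛ (tangentialFields slΛ) 1,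
      LinearIndependent ℝ (fun α : Set.Ioi (1 / 2 : ℝ) =>
        tanClass slΛ 1 ⟨aH3 (kHat α), hK α⟩) ∧
      LinearIndependent invPoly (fun α : Set.Ioi (1 / 2 : ℝ) =>
        tanClass slΛ 1 ⟨aH3 (kHat α), hK α⟩) ∧
      LinearIndependent invAnalytic (fun α : Set.Ioi (1 / 2 : ℝ) =>
        tanClass slΛ 1 ⟨aH3 (kHat α), hK α⟩)) ∧
    -- explicit families in degree 2
    (∃ hT : ∀ α : Set.Ioi (1 / 2 : ℝ), mulΛ (tHat α) ∈ cocycles slΛ (tangentialFields slΛ) 2,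
      LinearIndependent ℝ (fun α : Set.Ioi (1 / 2 : ℝ) =>
        tanClass slΛ 2 ⟨mulΛ (tHat α), hT α⟩)) ∧
    (∃ hK : ∀ α : Set.Ioi (1 / 2 : ℝ), mulΛ (kHat α) ∈ cocycles slΛ (tangentialFields slΛ) 2,
      LinearIndependent ℝ (fun α : Set.Ioi (1 / 2 : ℝ) =>
        tanClass slΛ 2 ⟨mulΛ (kHat α), hK α⟩) ∧
      LinearIndependent invPoly (fun α : Set.Ioi (1 / 2 : ℝ) =>
        tanClass slΛ 2 ⟨mulΛ (kHat α), hK α⟩) ∧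
      LinearIndependent invAnalytic (fun α : Set.Ioi (1 / 2 : ℝ) =>
        tanClass slΛ 2 ⟨mulΛ (kHat α), hK α⟩)) ∧
    -- infinite-dimensionality
    IsInfiniteDim (HTan slΛ 1) ∧ IsInfiniteDim (HTan slΛ 2) ∧
    (∀ k : ℕ, 1 ≤ k → k ≤ 3 → IsInfiniteDim (HP slΛ k)) := by
  have hmono : StrictMono ((↑) : Set.Ioi (1 / 2 : ℝ) → ℝ) := Subtype.strictMono_coe _
  have hpos (α : Set.Ioi (1 / 2 : ℝ)) : 0 < (α : ℝ) := one_half_pos.trans α.2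
  have hdeg₁ {ψ : ℝ → ℝ} (hψ : ContDiffOn ℝ ∞ ψ (Set.Ioi 0)) := radial_smul_hamX3_mem_cocycles hψ
  have hdeg₂ {ψ : ℝ → ℝ} (hψ : ContDiffOn ℝ ∞ ψ (Set.Ioi 0)) := radial_smul_slΛ_mem_cocycles hψ
  refine ⟨nonempty_HTan_zero_equiv slΛ, fun k hk => subsingleton_HTan (fun x =>
      ⟨casimirCovector x, casimirCovector_ne_zero x, slΛ_casimirCovector x⟩) hk,
    fun a f ha hf h => exists_tendsto_integral_of_isSigma_smul_hamX3 ha (fun _ => hf) h,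
    fun φ _ hinv ⟨B, hB, h⟩ => exists_tendsto_integral_of_isSigma_smul_slΛ hinv hB.1 h,
    ⟨fun α => hdeg₁ (contDiffOn_powProfile α),
      linearIndependent_powProfile hasLimitObstruction_hamX3 hmono Subtype.prop _⟩,
    ⟨fun α => hdeg₁ (contDiffOn_expProfile α), linearIndependent_of_invAnalytic <|
      linearIndependent_invAnalytic_expProfile hasLimitObstruction_hamX3 hmono hpos _⟩,
    ⟨fun α => hdeg₂ (contDiffOn_powProfile α),
      linearIndependent_powProfile hasLimitObstruction_slΛ hmono Subtype.prop _⟩,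
    ⟨fun α => hdeg₂ (contDiffOn_expProfile α), linearIndependent_of_invAnalytic <|
      linearIndependent_invAnalytic_expProfile hasLimitObstruction_slΛ hmono hpos _⟩,
    hasLimitObstruction_hamX3.isInfiniteDim_cohomology fun α => hdeg₁ (contDiffOn_expProfile α),
    hasLimitObstruction_slΛ.isInfiniteDim_cohomology fun α => hdeg₂ (contDiffOn_expProfile α),
    fun k hk₁ hk₃ => ?_⟩
  interval_cases k
  · exact hasLimitObstruction_hamX3.isInfiniteDim_cohomology fun α =>
      cocycles_tangentialFields_le slΛ 1 (hdeg₁ (contDiffOn_expProfile α))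
  · exact hasLimitObstruction_slΛ.isInfiniteDim_cohomology fun α =>
      cocycles_tangentialFields_le slΛ 2 (hdeg₂ (contDiffOn_expProfile α))
  · exact hasLimitObstruction_volField.isInfiniteDim_cohomology fun α =>
      radial_smul_volField_mem_cocycles (contDiffOn_expProfile α)
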